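/- Let $0<L_0<L_2$, $H>0$, $\kappa\ge 0$, and let $\Omega\subset\mathbb R^2$ (coordinates $(x,z)$) be a bounded open set with $\Omega\cap\{x<L_2\}=(0,L_2)\times(0,H)$ such that $\Omega_2=\Omega\cap\{x>L_0\}$ is connected with Lipschitz boundary. Up to a set of zero length, $\partial\Omega$ is the disjoint union of $\Gamma_L=\{0\}\times(0,H)$ and of measurable parts $\Gamma_T\supset(0,L_2)\times\{H\}$, $\Gamma_B\supset(0,L_2)\times\{0\}$ and $\Gamma_R$. Put $\Omega_1=(0,L_0)$, $\Gamma=\{L_0\}\times(0,H)$, and write $\bar f(x)=\frac1H\int_0^H f(x,z)\,dz$. Let $F\in L^2(\Omega)$, let $\gamma_1$ be integrable on $\Gamma_L$, and let $\gamma_2$ be the trace on $\Gamma_R$ of a function of $H^1(\Omega_2)$; $n$ denotes the outward unit normal of $\Omega_2$, so $\partial_n=-\partial_x$ on $\Gamma$. For $\lambda>0$ the Schwarz iteration is the following. Given $u_2^0\in H^1(\Omega_2)$ possessing a normal derivative in $L^2(\Gamma)$ (in the sense of Green's formula, with $\Delta u_2^0\in L^2(\Omega_2)$), for $k\ge 0$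 solve $$-(u_1^{k+1})''+\tfrac{\kappa}{H}u_1^{k+1}=\bar F\ \text{ in }(0,L_0),\qquad u_1^{k+1}(0)=\bar\gamma_1,\qquad \Big(\tfrac{\partial}{\partial x}+\lambda\Big)u_1^{k+1}(L_0)=\frac1H\int_0^H\Big(\tfrac{\partial}{\partial x}+\lambda\Big)u_2^{k}(L_0,z)\,dz,$$ and then solve, in the weak sense in $H^1(\Omega_2)$, $$-\Delta u_2^{k+1}=F\ \text{in }\Omega_2,\quad \partial_n u_2^{k+1}=0\ \text{on }\Gamma_T\cap\partial\Omega_2,\quad \partial_n u_2^{k+1}+\kappa u_2^{k+1}=0\ \text{on }\Gamma_B\cap\partial\Omega_2,\quad u_2^{k+1}=\gamma_2\ \text{on }\Gamma_R,$$ $$-\frac{\partial u_2^{k+1}}{\partial x}(L_0,z)+\lambda u_2^{k+1}(L_0,z)=-(u_1^{k+1})'(L_0)+\lambda u_1^{k+1}(L_0)\quad\text{on }\Gamma .$$ Then, for every $\lambda>0$, the iteration can be carried out from every such $u_2^0$, and there is a pair $(u_1^\lambda,u_2^\lambda)\in H^1(\Omega_1)\times H^1(\Omega_2)$, not depending on $u_2^0$,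 such that $(u_1^k,u_2^k)\to(u_1^\lambda,u_2^\lambda)$ in $H^1(\Omega_1)\times H^1(\Omega_2)$ for every such iteration. The limit solves the above equations in $(0,L_0)$ and $\Omega_2$ with the above outer boundary conditions and the above Robin condition on $\Gamma$ (without the indices $k+1$), and it satisfies the physical coupling constraints $$u_1^\lambda(L_0)=\frac1H\int_0^H u_2^\lambda(L_0,z)\,dz,\qquad (u_1^\lambda)'(L_0)=\frac1H\int_0^H\frac{\partial u_2^\lambda}{\partial x}(L_0,z)\,dz .$$ -/

import Mathlib

open MeasureTheory Filter Topology Set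
open scoped ContDiff NNReal ENNReal

noncomputable section

namespace SchwarzCoupling

/-- The Euclidean plane; the coordinates are `x = p 0` and `z = p 1`. -/
abbrev Plane : Type := EuclideanSpace ℝ (Fin 2)

/-- The point `(x, z)`. -/
def pt (x z : ℝ) : Plane := !₂[x, z]

/-- Arc length: one-dimensional Hausdorff measure of the Euclidean plane. -/
def arc : Measure Plane := Measure.hausdorffMeasure 1

/-- `Ω` has a Lipschitz boundary: near each boundary point `p`, in suitable orthonormal coordinates
`(s, t)` centred at `p`, the set `Ω` is the part of a box lying above a Lipschitz graph. -/
def HasLipschitzBoundary (Ω : Set Plane) : Prop :=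
  ∀ p ∈ frontier Ω, ∃ (e : Plane ≃ₗᵢ[ℝ] Plane) (r h : ℝ) (K : ℝ≥0) (ψ : ℝ → ℝ),
    0 < r ∧ 0 < h ∧ LipschitzWith K ψ ∧ (∀ s, |s| < r → |ψ s| < h) ∧
    ∀ s t, |s| < r → |t| < h → (p + e (pt s t) ∈ Ω ↔ ψ s < t)

/-- Elements of the Sobolev space `H¹(Ω)`: a square integrable function together with its square
integrable weak gradient. -/
structure H1 (Ω : Set Plane) where
  /-- the function -/
  val : Plane → ℝ
  /-- its weak gradient -/
  grad : Plane → Plane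
  memLp_val : MemLp val 2 (volume.restrict Ω)
  memLp_grad : MemLp grad 2 (volume.restrict Ω)
  weak : ∀ φ : Plane → ℝ, ContDiff ℝ ∞ φ → HasCompactSupport φ → tsupport φ ⊆ Ω →
    ∫ p in Ω, val p • gradient φ p = - ∫ p in Ω, φ p • grad p

/-- `w ∈ L²(∂Ω)` is the boundary trace of `u ∈ H¹(Ω)`: it is the `L²(∂Ω)`-limit of the boundary
values of functions smooth up to the boundary that converge to `u` in `H¹(Ω)`. -/
def H1.HasTrace {Ω : Set Plane} (u : H1 Ω) (w : Plane → ℝ) : Prop :=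
  MemLp w 2 (arc.restrict (frontier Ω)) ∧
  ∃ φ : ℕ → Plane → ℝ, (∀ n, ContDiff ℝ ∞ (φ n)) ∧
    Tendsto (fun n => eLpNorm (fun p => φ n p - u.val p) 2 (volume.restrict Ω)) atTop (𝓝 0) ∧
    Tendsto (fun n => eLpNorm (fun p => gradient (φ n) p - u.grad p) 2 (volume.restrict Ω))
      atTop (𝓝 0) ∧
    Tendsto (fun n => eLpNorm (fun p => φ n p - w p) 2 (arc.restrict (frontier Ω))) atTop (𝓝 0)

/-- `q ∈ L²(Γ)` is the outward normal derivative of `u` on the part `Γ` of `∂Ω`: the weak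
Laplacian `ℓ` of `u` is square integrable, and Green's formula
`∫_Ω ∇u·∇v + ∫_Ω (Δu) v = ∫_Γ q v` holds for all `v ∈ H¹(Ω)` that vanish on `∂Ω \ Γ`. -/
def H1.HasNormalDeriv {Ω : Set Plane} (u : H1 Ω) (Γ : Set Plane) (q : Plane → ℝ) : Prop :=
  MemLp q 2 (arc.restrict Γ) ∧
  ∃ l : Plane → ℝ, MemLp l 2 (volume.restrict Ω) ∧
    ∀ (v : H1 Ω) (w : Plane → ℝ), v.HasTrace w →
      (∀ᵐ p ∂(arc.restrict (frontier Ω \ Γ)), w p = 0) →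
      (∫ p in Ω, inner ℝ (u.grad p) (v.grad p)) + ∫ p in Ω, l p * v.val p
        = ∫ p in Γ, q p * w p ∂arc

/-- The computational domain. For `x < L₂` it is the thin rectangle `(0, L₂) × (0, H)`, and the
interface abscissa `L₀` is taken in `(0, L₂)`. The boundary consists of the left side, the top
part `ΓT`, the bottom part `ΓB` and the right part `ΓR`. -/
structure Geometry where
  L₀ : ℝ
  L₂ : ℝ
  H : ℝ
  L₀_pos : 0 < L₀
  L₀_lt : L₀ < L₂
  H_pos : 0 < H
  Ω : Set Plane
  ΓT : Set Plane
  ΓB : Set Plane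
  ΓR : Set Plane
  isOpen : IsOpen Ω
  bounded : Bornology.IsBounded Ω
  thin : ∀ p : Plane, p 0 < L₂ → (p ∈ Ω ↔ 0 < p 0 ∧ 0 < p 1 ∧ p 1 < H)
  connected : IsConnected (Ω ∩ {p | L₀ < p 0})
  lipschitz : HasLipschitzBoundary (Ω ∩ {p | L₀ < p 0})
  measurable_ΓT : MeasurableSet ΓT
  measurable_ΓB : MeasurableSet ΓB
  measurable_ΓR : MeasurableSet ΓR
  ΓT_subset : ΓT ⊆ frontier Ω
  ΓB_subset : ΓB ⊆ frontier Ω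
  ΓR_subset : ΓR ⊆ frontier Ω
  disjoint_TB : Disjoint ΓT ΓB
  disjoint_TR : Disjoint ΓT ΓR
  disjoint_BR : Disjoint ΓB ΓR
  top_thin : ∀ x, 0 < x → x < L₂ → pt x H ∈ ΓT
  bottom_thin : ∀ x, 0 < x → x < L₂ → pt x 0 ∈ ΓB
  cover : arc (frontier Ω \ (ΓT ∪ ΓB ∪ ΓR ∪ {p | p 0 = 0 ∧ 0 < p 1 ∧ p 1 < H})) = 0

namespace Geometry

variable (G : Geometry)

/-- The subdomain `Ω₂ = Ω ∩ {x > L₀}` in which the 2-D model is kept. -/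
def Ω₂ : Set Plane := G.Ω ∩ {p | G.L₀ < p 0}

/-- The interface `Γ = {L₀} × (0, H)`. -/
def Γ : Set Plane := {p | p 0 = G.L₀ ∧ 0 < p 1 ∧ p 1 < G.H}

/-- The average over `0 < z < H` of `f (x, z)`. -/
def avg (f : Plane → ℝ) (x : ℝ) : ℝ := (1 / G.H) * ∫ z in (0 : ℝ)..G.H, f (pt x z)

end Geometry

/-- `γ` is the trace on `ΓR` of some element of `H¹(Ω₂)`, i.e. it lies in `H^{1/2}(ΓR)`. -/
def IsDirichletDatum (G : Geometry) (γ : Plane → ℝ) : Prop :=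
  ∃ (u : H1 G.Ω₂) (w : Plane → ℝ), u.HasTrace w ∧
    ∀ᵐ p ∂(arc.restrict (G.ΓR ∩ frontier G.Ω₂)), w p = γ p

/-- `u`, with derivative `du`, is the (`H²`) solution of the 1-D model
`-u'' + (κ/H) u = F₁` a.e. in `(0, L₀)`, `u(0) = γ̄₁`, where `F₁` and `γ̄₁` are the vertical
averages of `F` and `γ₁`. -/
structure IsSolution1D (G : Geometry) (κ : ℝ) (F γ₁ : Plane → ℝ) (u du : ℝ → ℝ) : Prop where
  hasDeriv : ∀ x ∈ Icc 0 G.L₀, HasDerivWithinAt u (du x) (Icc 0 G.L₀) x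
  absCont : AbsolutelyContinuousOnInterval du 0 G.L₀
  eqn : ∀ᵐ x, x ∈ Ioo 0 G.L₀ → -deriv du x + κ / G.H * u x = G.avg F x
  left : u 0 = G.avg γ₁ 0

/-- `u` is the weak solution of `-Δu = F` in `Ω₂`, `∂ₙu = 0` on `ΓT`, `∂ₙu + κ u = 0` on `ΓB`,
`u = γ₂` on `ΓR`, and `∂ₙu + lam u = c` on the interface `Γ`. -/
def IsSolution2D (G : Geometry) (κ lam : ℝ) (F γ₂ : Plane → ℝ) (c : ℝ) (u : H1 G.Ω₂) : Prop :=
  ∃ w : Plane → ℝ, u.HasTrace w ∧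
    (∀ᵐ p ∂(arc.restrict (G.ΓR ∩ frontier G.Ω₂)), w p = γ₂ p) ∧
    ∀ (v : H1 G.Ω₂) (y : Plane → ℝ), v.HasTrace y →
      (∀ᵐ p ∂(arc.restrict (G.ΓR ∩ frontier G.Ω₂)), y p = 0) →
      (∫ p in G.Ω₂, inner ℝ (u.grad p) (v.grad p))
          + κ * (∫ p in G.ΓB ∩ frontier G.Ω₂, w p * y p ∂arc)
          + lam * (∫ p in G.Γ, w p * y p ∂arc)
        = (∫ p in G.Ω₂, F p * v.val p) + ∫ p in G.Γ, c * y p ∂arc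

/-- The number `m` is the average over `Γ` of the trace of `u`, and `d` is the average over `Γ` of
`∂u/∂x`. Since the outward normal of `Ω₂` on `Γ` is `-e_x`, one has `∂u/∂x = -∂ₙu` there. -/
def HasInterfaceAverages (G : Geometry) (u : H1 G.Ω₂) (m d : ℝ) : Prop :=
  ∃ w q : Plane → ℝ, u.HasTrace w ∧ u.HasNormalDeriv G.Γ q ∧
    m = G.avg w G.L₀ ∧ d = G.avg (fun p => -q p) G.L₀

/-- The Robin condition `B₁ u₁ = B₁ ū₂` at `x = L₀`, where `B₁ = ∂/∂x + lam`. -/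
def Robin1D (G : Geometry) (lam : ℝ) (u₁ du₁ : ℝ → ℝ) (u₂ : H1 G.Ω₂) : Prop :=
  ∃ m d : ℝ, HasInterfaceAverages G u₂ m d ∧ du₁ G.L₀ + lam * u₁ G.L₀ = d + lam * m

/-- The constant value on `Γ` of `B₂ u₁`, where `B₂ = ∂/∂n₂ + lam = -∂/∂x + lam` and `u₁` is
extended constantly in `z`. -/
def robinDatum2D (G : Geometry) (lam : ℝ) (u₁ du₁ : ℝ → ℝ) : ℝ :=
  -du₁ G.L₀ + lam * u₁ G.L₀

/-- The Schwarz iteration started from `u₂ 0`. The entries `u₁ 0`, `du₁ 0` play no role. -/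
def IsSchwarzIteration (G : Geometry) (κ lam : ℝ) (F γ₁ γ₂ : Plane → ℝ)
    (u₁ du₁ : ℕ → ℝ → ℝ) (u₂ : ℕ → H1 G.Ω₂) : Prop :=
  ∀ k : ℕ,
    IsSolution1D G κ F γ₁ (u₁ (k + 1)) (du₁ (k + 1)) ∧
    Robin1D G lam (u₁ (k + 1)) (du₁ (k + 1)) (u₂ k) ∧
    IsSolution2D G κ lam F γ₂ (robinDatum2D G lam (u₁ (k + 1)) (du₁ (k + 1))) (u₂ (k + 1))

/-- Convergence in `H¹(0, L₀)`. -/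
def ConvergesH1Interval (L₀ : ℝ) (u du : ℕ → ℝ → ℝ) (v dv : ℝ → ℝ) : Prop :=
  Tendsto (fun k => eLpNorm (fun x => u k x - v x) 2 (volume.restrict (Ioo 0 L₀))) atTop (𝓝 0) ∧
  Tendsto (fun k => eLpNorm (fun x => du k x - dv x) 2 (volume.restrict (Ioo 0 L₀))) atTop (𝓝 0)

/-- Convergence in `H¹(Ω)`. -/
def ConvergesH1 {Ω : Set Plane} (u : ℕ → H1 Ω) (v : H1 Ω) : Prop :=
  Tendsto (fun k => eLpNorm (fun p => (u k).val p - v.val p) 2 (volume.restrict Ω))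
    atTop (𝓝 0) ∧
  Tendsto (fun k => eLpNorm (fun p => (u k).grad p - v.grad p) 2 (volume.restrict Ω))
    atTop (𝓝 0)

end SchwarzCoupling

end

/-!
The 1-D problem turns an incoming Robin datum `u' + lam u` at `x = L₀` into an outgoing datum
`-u' + lam u`, and the 2-D problem turns the latter, after averaging over `Γ`, into the former; one
step of the Schwarz iteration is the composition of these two affine reflections of `ℝ`. The 1-D
reflection is a strict contraction, as the explicit solutions of the homogeneous equation show. The
2-D reflection is nonexpansive: testing the difference `w` of two solutions with itself gives
`lam ∫_Γ w² ≤ (c - c') ∫_Γ w`, and by the Cauchy–Schwarz inequality the mean `m` of `w` satisfies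
`lam m² ≤ (c - c') m`, that is `|2 lam m - (c - c')| ≤ |c - c'|`. So the data converge to the unique
fixed point, and the solutions, which depend continuously on their data, converge as well. At the
fixed point, both `d + lam m` and `-d + lam m` agree for the 1-D and the 2-D solution, hence so do
the values `m` and the derivatives `d`.

The 2-D problem is solved by the Lax–Milgram theorem in the closure of the triples
`(φ, ∇φ, φ|_∂Ω₂)`, `φ` smooth. Both inequalities that this needs, the trace inequality and the
Poincaré inequality with the boundary term on `Γ`, come from integrating along the vertical segments
of the Lipschitz graph charts; connectedness propagates the second one from `Γ` to all of `Ω₂`.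
-/

noncomputable section

namespace SchwarzCoupling

/-! ### The equation `-u'' + k u = f` on an interval -/

lemma absolutelyContinuousOnInterval_of_hasDerivWithinAt {f f' : ℝ → ℝ} {a b : ℝ} (hab : a ≤ b)
    (hf : ∀ x ∈ Icc a b, HasDerivWithinAt f (f' x) (Icc a b) x) (hc : ContinuousOn f' (Icc a b)) :
    AbsolutelyContinuousOnInterval f a b := by
  obtain ⟨K, hK⟩ := isCompact_Icc.exists_bound_of_continuousOn hc
  have hL : LipschitzOnWith K.toNNReal f (Icc a b) :=
    (convex_Icc a b).lipschitzOnWith_of_nnnorm_hasDerivWithin_le hf fun x hx => by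
      rw [← NNReal.coe_le_coe, coe_nnnorm]
      exact (hK x hx).trans (Real.le_coe_toNNReal K)
  rw [← uIcc_of_le hab] at hL
  exact hL.absolutelyContinuousOnInterval

/-- `C` and `S` are the solutions of `y'' = k y` with `(y, y')(0) = (1, 0)` and `(0, 1)`; positivity
is part of the definition because it holds exactly when `0 ≤ k`. -/
structure IsFundamentalPair (k : ℝ) (C S : ℝ → ℝ) : Prop where
  hasDerivAt_C : ∀ x, HasDerivAt C (k * S x) x
  hasDerivAt_S : ∀ x, HasDerivAt S (C x) x
  C_zero : C 0 = 1
  S_zero : S 0 = 0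
  C_pos : ∀ x, 0 < C x
  S_pos : ∀ x, 0 < x → 0 < S x

lemma exists_isFundamentalPair {k : ℝ} (hk : 0 ≤ k) : ∃ C S, IsFundamentalPair k C S := by
  rcases hk.eq_or_lt with rfl | hk
  · exact ⟨fun _ => 1, fun x => x, fun x => by simpa using hasDerivAt_const x (1 : ℝ),
      fun x => hasDerivAt_id x, rfl, rfl, fun _ => one_pos, fun _ h => h⟩
  · have hs : 0 < √k := Real.sqrt_pos.2 hk
    refine ⟨fun x => Real.cosh (√k * x), fun x => Real.sinh (√k * x) / √k, fun x => ?_, fun x => ?_,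
      by simp, by simp, fun x => Real.cosh_pos _, fun x hx => ?_⟩
    · refine ((hasDerivAt_id x).const_mul (√k)).cosh.congr_deriv ?_
      have := Real.mul_self_sqrt hk.le
      simp only [id, mul_one]
      field_simp
      linear_combination (Real.sinh (√k * x)) * this
    · refine (((hasDerivAt_id x).const_mul (√k)).sinh.div_const (√k)).congr_deriv ?_
      simp only [id, mul_one]
      field_simp
    · exact div_pos (Real.sinh_pos_iff.2 (mul_pos hs hx)) hs

namespace IsFundamentalPair

variable {k : ℝ} {C S : ℝ → ℝ}

lemma continuous_C (h : IsFundamentalPair k C S) : Continuous C :=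
  continuous_iff_continuousAt.2 fun x => (h.hasDerivAt_C x).continuousAt

lemma continuous_S (h : IsFundamentalPair k C S) : Continuous S :=
  continuous_iff_continuousAt.2 fun x => (h.hasDerivAt_S x).continuousAt

lemma absolutelyContinuousOnInterval_C (h : IsFundamentalPair k C S) {a b : ℝ} (hab : a ≤ b) :
    AbsolutelyContinuousOnInterval C a b :=
  absolutelyContinuousOnInterval_of_hasDerivWithinAt hab
    (fun x _ => (h.hasDerivAt_C x).hasDerivWithinAt) (h.continuous_S.const_smul k).continuousOn

lemma absolutelyContinuousOnInterval_S (h : IsFundamentalPair k C S) {a b : ℝ} (hab : a ≤ b) :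
    AbsolutelyContinuousOnInterval S a b :=
  absolutelyContinuousOnInterval_of_hasDerivWithinAt hab
    (fun x _ => (h.hasDerivAt_S x).hasDerivWithinAt) h.continuous_C.continuousOn

lemma wronskian (h : IsFundamentalPair k C S) (x : ℝ) : C x ^ 2 - k * S x ^ 2 = 1 := by
  have hd : ∀ y, HasDerivAt (fun y => C y ^ 2 - k * S y ^ 2) 0 y := fun y =>
    (((h.hasDerivAt_C y).pow 2).sub (((h.hasDerivAt_S y).pow 2).const_mul k)).congr_deriv
      (by simp; ring)
  have := is_const_of_deriv_eq_zero (fun y => (hd y).differentiableAt) (fun y => (hd y).deriv) x 0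
  simpa [h.C_zero, h.S_zero] using this

end IsFundamentalPair

lemma hasDerivWithinAt_of_ae_hasDerivAt {y g : ℝ → ℝ} {a b : ℝ} (hab : a ≤ b)
    (hy : AbsolutelyContinuousOnInterval y a b) (hg : ContinuousOn g (Icc a b))
    (h : ∀ᵐ x, x ∈ uIcc a b → HasDerivAt y (g x) x) :
    ∀ x ∈ Icc a b, HasDerivWithinAt y (g x) (Icc a b) x := by
  have hint : IntervalIntegrable g volume a b := (uIcc_of_le hab ▸ hg).intervalIntegrable
  obtain ⟨c, hc⟩ := (hy.sub (hint.absolutelyContinuousOnInterval_intervalIntegral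
    (c := a) (by simp))).const_of_ae_hasDerivAt_zero (by
      filter_upwards [h, hint.ae_hasDerivAt_integral] with x hx hx' hxm
      exact ((hx hxm).sub (hx' hxm a (by simp))).congr_deriv (sub_self _))
  rw [uIcc_of_le hab] at hc
  have hy_eq : ∀ x ∈ Icc a b, y x = (∫ t in a..x, g t) + c := fun x hx =>
    sub_eq_iff_eq_add'.1 (hc x hx)
  intro x hx
  have : Fact (x ∈ Icc a b) := ⟨hx⟩
  refine HasDerivWithinAt.congr ?_ hy_eq (hy_eq x hx)
  refine HasDerivWithinAt.add_const c (intervalIntegral.integral_hasDerivWithinAt_right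
    (hint.mono_set (uIcc_subset_uIcc (by simp) (by simpa [uIcc_of_le hab] using hx)))
    (hg.stronglyMeasurableAtFilter_nhdsWithin measurableSet_Icc x) (hg x hx))

/-- Variation of constants. The kernel formula yields the derivatives only almost everywhere; the
first one is continuous, hence exists everywhere. -/
lemma exists_solution_secondOrder {k L : ℝ} (hk : 0 ≤ k) (hL : 0 ≤ L) {f : ℝ → ℝ}
    (hf : IntervalIntegrable f volume 0 L) (c : ℝ) :
    ∃ u du : ℝ → ℝ, (∀ x ∈ Icc 0 L, HasDerivWithinAt u (du x) (Icc 0 L) x) ∧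
      AbsolutelyContinuousOnInterval du 0 L ∧
      (∀ᵐ x, x ∈ Icc 0 L → -deriv du x + k * u x = f x) ∧ u 0 = c := by
  obtain ⟨C, S, h⟩ := exists_isFundamentalPair hk
  have hCf : IntervalIntegrable (fun t => C t * f t) volume 0 L :=
    hf.continuousOn_mul h.continuous_C.continuousOn
  have hSf : IntervalIntegrable (fun t => S t * f t) volume 0 L :=
    hf.continuousOn_mul h.continuous_S.continuousOn
  set A : ℝ → ℝ := fun x => ∫ t in (0 : ℝ)..x, C t * f t with hA
  set B : ℝ → ℝ := fun x => ∫ t in (0 : ℝ)..x, S t * f t with hB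
  set u : ℝ → ℝ := fun x => c * C x - (S x * A x - C x * B x) with hu
  set du : ℝ → ℝ := fun x => k * (c * S x) - (C x * A x - k * (S x * B x)) with hdu
  have hAac := hCf.absolutelyContinuousOnInterval_intervalIntegral (c := 0) (by simp)
  have hBac := hSf.absolutelyContinuousOnInterval_intervalIntegral (c := 0) (by simp)
  have hCac := h.absolutelyContinuousOnInterval_C hL
  have hSac := h.absolutelyContinuousOnInterval_S hL
  have huac : AbsolutelyContinuousOnInterval u 0 L :=
    (hCac.const_mul c).sub ((hSac.mul hAac).sub (hCac.mul hBac))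
  have hduac : AbsolutelyContinuousOnInterval du 0 L :=
    ((hSac.const_mul c).const_mul k).sub ((hCac.mul hAac).sub ((hSac.mul hBac).const_mul k))
  have hderiv : ∀ᵐ x, x ∈ uIcc 0 L → HasDerivAt u (du x) x ∧ HasDerivAt du (k * u x - f x) x := by
    filter_upwards [hCf.ae_hasDerivAt_integral, hSf.ae_hasDerivAt_integral] with x hAx hBx hx
    have hA' : HasDerivAt A (C x * f x) x := hAx hx 0 (by simp)
    have hB' : HasDerivAt B (S x * f x) x := hBx hx 0 (by simp)
    have hC' := h.hasDerivAt_C x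
    have hS' := h.hasDerivAt_S x
    exact ⟨((hC'.const_mul c).sub ((hS'.mul hA').sub (hC'.mul hB'))).congr_deriv
        (by simp only [hdu]; ring),
      (((hS'.const_mul c).const_mul k).sub
        ((hC'.mul hA').sub ((hS'.mul hB').const_mul k))).congr_deriv
        (by simp only [hu]; linear_combination (-f x) * h.wronskian x)⟩
  refine ⟨u, du, hasDerivWithinAt_of_ae_hasDerivAt hL huac (uIcc_of_le hL ▸ hduac.continuousOn)
    (hderiv.mono fun x hx hxm => (hx hxm).1), hduac, ?_, ?_⟩
  · filter_upwards [hderiv] with x hx hxm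
    rw [(hx (uIcc_of_le hL ▸ hxm)).2.deriv]
    ring
  · simp [hu, hA, hB, h.C_zero, h.S_zero]

/-- The quantities `p = v C - v' S` and `q = v' C - k v S` are constant, and `p` vanishes at `0`. -/
lemma eq_mul_of_secondOrder_homogeneous {k L : ℝ} {C S v dv : ℝ → ℝ} (h : IsFundamentalPair k C S)
    (hL : 0 ≤ L) (hd : ∀ x ∈ Icc 0 L, HasDerivWithinAt v (dv x) (Icc 0 L) x)
    (hac : AbsolutelyContinuousOnInterval dv 0 L)
    (heq : ∀ᵐ x, x ∈ Ioo 0 L → deriv dv x = k * v x) (h0 : v 0 = 0) :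
    ∃ a : ℝ, ∀ x ∈ Icc 0 L, v x = a * S x ∧ dv x = a * C x := by
  have hvac := absolutelyContinuousOnInterval_of_hasDerivWithinAt hL hd
    (by simpa [uIcc_of_le hL] using hac.continuousOn)
  have hCac := h.absolutelyContinuousOnInterval_C hL
  have hSac := h.absolutelyContinuousOnInterval_S hL
  have hderiv : ∀ᵐ x, x ∈ uIcc 0 L → HasDerivAt v (dv x) x ∧ HasDerivAt dv (k * v x) x := by
    filter_upwards [heq, hac.ae_differentiableAt, (Ioo_ae_eq_Icc (μ := volume)).mem_iff]
      with x he hdiff hmem hx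
    have hx' : x ∈ Icc 0 L := uIcc_of_le hL ▸ hx
    have hx'' : x ∈ Ioo 0 L := hmem.2 hx'
    exact ⟨(hd x hx').hasDerivAt (Icc_mem_nhds hx''.1 hx''.2), he hx'' ▸ (hdiff hx).hasDerivAt⟩
  obtain ⟨p, hp⟩ := ((hvac.mul hCac).sub (hac.mul hSac)).const_of_ae_hasDerivAt_zero (by
    filter_upwards [hderiv] with x hx hxm
    exact (((hx hxm).1.mul (h.hasDerivAt_C x)).sub
      ((hx hxm).2.mul (h.hasDerivAt_S x))).congr_deriv (by ring))
  obtain ⟨q, hq⟩ :=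
    ((hac.mul hCac).sub ((hvac.mul hSac).const_mul k)).const_of_ae_hasDerivAt_zero (by
      filter_upwards [hderiv] with x hx hxm
      exact (((hx hxm).2.mul (h.hasDerivAt_C x)).sub
        (((hx hxm).1.mul (h.hasDerivAt_S x)).const_mul k)).congr_deriv (by ring))
  rw [uIcc_of_le hL] at hp hq
  simp only [Pi.sub_apply, Pi.mul_apply] at hp hq
  have hp0 : p = 0 := by rw [← hp 0 ⟨le_rfl, hL⟩, h0, h.S_zero]; ring
  refine ⟨q, fun x hx => ⟨?_, ?_⟩⟩
  · linear_combination C x * hp x hx + S x * hq x hx - v x * h.wronskian x + C x * hp0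
  · linear_combination k * S x * hp x hx + C x * hq x hx - dv x * h.wronskian x + k * S x * hp0

/-! ### Cartesian coordinates, the interface and vertical averages -/

@[simp] lemma pt_apply_zero (x z : ℝ) : pt x z 0 = x := by simp [pt]

@[simp] lemma pt_apply_one (x z : ℝ) : pt x z 1 = z := by simp [pt]

lemma pt_eta (p : Plane) : pt (p 0) (p 1) = p := by
  ext i; fin_cases i <;> simp

lemma pt_zero : pt 0 0 = 0 := by
  ext i; fin_cases i <;> simp

lemma pt_add (x z x' z' : ℝ) : pt x z + pt x' z' = pt (x + x') (z + z') := by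
  ext i; fin_cases i <;> simp

lemma smul_pt (c x z : ℝ) : c • pt x z = pt (c * x) (c * z) := by
  ext i; fin_cases i <;> simp

lemma norm_pt_sq (x z : ℝ) : ‖pt x z‖ ^ 2 = x ^ 2 + z ^ 2 := by
  simp [EuclideanSpace.norm_sq_eq, Fin.sum_univ_two]

lemma enorm_pt_zero_one : ‖pt 0 1‖ₑ = 1 := by
  have h : ‖pt 0 1‖ = 1 := by nlinarith [norm_pt_sq 0 1, norm_nonneg (pt 0 1)]
  rw [← ofReal_norm, h, ENNReal.ofReal_one]

/-- Cartesian coordinates as a homeomorphism. -/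
def ptHomeo : ℝ × ℝ ≃ₜ Plane :=
  Homeomorph.finTwoArrow.symm.trans (PiLp.homeomorph 2 fun _ : Fin 2 => ℝ).symm

lemma ptHomeo_apply (q : ℝ × ℝ) : ptHomeo q = pt q.1 q.2 := by
  ext i; fin_cases i <;> rfl

lemma measurePreserving_ptHomeo : MeasurePreserving ptHomeo :=
  (PiLp.volume_preserving_toLp (Fin 2)).comp (volume_preserving_finTwoArrow ℝ).symm

lemma isometry_pt_right (x : ℝ) : Isometry fun z => pt x z := by
  refine Isometry.of_dist_eq fun z z' => ?_
  rw [EuclideanSpace.dist_eq, Fin.sum_univ_two]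
  simp [Real.sqrt_sq_eq_abs, Real.dist_eq]

namespace Geometry

variable (G : Geometry)

lemma measurableSet_Γ : MeasurableSet G.Γ := by
  have h0 : Measurable fun p : Plane => p 0 := by fun_prop
  have h1 : Measurable fun p : Plane => p 1 := by fun_prop
  exact (measurableSet_eq_fun h0 measurable_const).inter
    ((measurableSet_lt measurable_const h1).inter (measurableSet_lt h1 measurable_const))

lemma preimage_Γ : (fun z => pt G.L₀ z) ⁻¹' G.Γ = Ioo 0 G.H := by
  ext z; simp [Γ]

lemma measurableEmbedding_interface : MeasurableEmbedding fun z => pt G.L₀ z :=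
  (isometry_pt_right G.L₀).isClosedEmbedding.measurableEmbedding

lemma arc_restrict_Γ :
    arc.restrict G.Γ = (volume.restrict (Ioo 0 G.H)).map fun z => pt G.L₀ z := by
  have h := (isometry_pt_right G.L₀).map_hausdorffMeasure (d := 1) (Or.inl zero_le_one)
  rw [hausdorffMeasure_real] at h
  rw [← preimage_Γ, ← G.measurableEmbedding_interface.restrict_map, h,
    Measure.restrict_restrict G.measurableSet_Γ, inter_eq_left.2]
  · rfl
  · rintro p ⟨hp, -⟩
    exact ⟨p 1, by simp only; rw [← hp, pt_eta]⟩

lemma integral_Γ (f : Plane → ℝ) : ∫ p in G.Γ, f p ∂arc = ∫ z in (0 : ℝ)..G.H, f (pt G.L₀ z) := by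
  rw [arc_restrict_Γ, G.measurableEmbedding_interface.integral_map,
    intervalIntegral.integral_of_le G.H_pos.le, integral_Ioc_eq_integral_Ioo]

lemma arc_Γ : arc G.Γ = ENNReal.ofReal G.H := by
  have h : arc.restrict G.Γ univ = ENNReal.ofReal G.H := by
    rw [arc_restrict_Γ, G.measurableEmbedding_interface.map_apply]
    simp
  simpa using h

lemma avg_eq_integral_Γ (f : Plane → ℝ) : G.avg f G.L₀ = 1 / G.H * ∫ p in G.Γ, f p ∂arc := by
  rw [integral_Γ, avg]

lemma integrableOn_avg {F : Plane → ℝ} (hF : IntegrableOn F G.Ω) :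
    IntegrableOn (G.avg F) (Ioo 0 G.L₂) := by
  have hcoord : IntegrableOn (F ∘ ptHomeo) (ptHomeo ⁻¹' G.Ω) :=
    (measurePreserving_ptHomeo.restrict_preimage_emb ptHomeo.measurableEmbedding
      G.Ω).integrable_comp_emb ptHomeo.measurableEmbedding |>.2 hF
  have hrect : IntegrableOn (F ∘ ptHomeo) (Ioo 0 G.L₂ ×ˢ Ioo 0 G.H) := by
    refine hcoord.mono_set ?_
    rintro ⟨x, z⟩ ⟨hx, hz⟩
    rw [mem_preimage, ptHomeo_apply, G.thin _ (by simpa using hx.2)]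
    exact ⟨by simpa using hx.1, by simpa using hz⟩
  rw [IntegrableOn, Measure.volume_eq_prod, ← Measure.prod_restrict] at hrect
  refine (hrect.integral_prod_left.const_mul (1 / G.H)).congr (ae_of_all _ fun x => ?_)
  simp only [avg, Function.comp_apply, ptHomeo_apply]
  rw [intervalIntegral.integral_of_le G.H_pos.le, integral_Ioc_eq_integral_Ioo]

lemma intervalIntegrable_avg {F : Plane → ℝ} (hF : MemLp F 2 (volume.restrict G.Ω)) :
    IntervalIntegrable (G.avg F) volume 0 G.L₀ := by
  have : IsFiniteMeasure (volume.restrict G.Ω) := ⟨by simpa using G.bounded.measure_lt_top⟩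
  rw [intervalIntegrable_iff_integrableOn_Ioo_of_le G.L₀_pos.le]
  exact (G.integrableOn_avg (hF.integrable (by norm_num))).mono_set
    (Ioo_subset_Ioo_right G.L₀_lt.le)

end Geometry

/-! ### The one-dimensional reflection -/

/-- The value of `B₁ u = u' + lam u` at `x = L₀`, the Robin datum that the 1-D model takes in. -/
def robinDatum1D (G : Geometry) (lam : ℝ) (u du : ℝ → ℝ) : ℝ :=
  du G.L₀ + lam * u G.L₀

lemma memLp_restrict_of_continuous {X E : Type*} [PseudoMetricSpace X] [ProperSpace X]
    [MeasurableSpace X] [OpensMeasurableSpace X] [NormedAddCommGroup E]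
    [SecondCountableTopologyEither X E] {f : X → E} (hf : Continuous f) {μ : Measure X} {s : Set X}
    (hs : MeasurableSet s) (hb : Bornology.IsBounded s) (hμ : μ s ≠ ⊤) (p : ℝ≥0∞) :
    MemLp f p (μ.restrict s) := by
  have : IsFiniteMeasure (μ.restrict s) := ⟨by simpa using hμ.lt_top⟩
  obtain ⟨c, hc⟩ := hb.isCompact_closure.exists_bound_of_continuousOn hf.continuousOn
  refine MemLp.of_bound hf.aestronglyMeasurable c ?_
  filter_upwards [ae_restrict_mem hs] with x hx using hc x (subset_closure hx)

lemma eLpNorm_eq_of_eqOn_smul {α E : Type*} [MeasurableSpace α] [NormedAddCommGroup E]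
    [NormedSpace ℝ E] {μ : Measure α} {s : Set α} (hs : MeasurableSet s) {f g : α → E} {a : ℝ}
    (h : ∀ x ∈ s, f x = a • g x) (p : ℝ≥0∞) :
    eLpNorm f p (μ.restrict s) = ‖a‖ₑ * eLpNorm g p (μ.restrict s) := by
  rw [← eLpNorm_const_smul]
  exact eLpNorm_congr_ae ((ae_restrict_iff' hs).2 (ae_of_all _ h))

section

variable {G : Geometry} {κ lam : ℝ} {F γ₁ : Plane → ℝ} {C S u du v dv : ℝ → ℝ}

lemma exists_isSolution1D (hκ : 0 ≤ κ) (hF : MemLp F 2 (volume.restrict G.Ω)) :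
    ∃ u du, IsSolution1D G κ F γ₁ u du := by
  obtain ⟨u, du, hd, hac, heq, h0⟩ := exists_solution_secondOrder (div_nonneg hκ G.H_pos.le)
    G.L₀_pos.le (G.intervalIntegrable_avg hF) (G.avg γ₁ 0)
  exact ⟨u, du, hd, hac, heq.mono fun x hx hm => hx (Ioo_subset_Icc_self hm), h0⟩

lemma IsSolution1D.ae_differentiableAt (hu : IsSolution1D G κ F γ₁ u du) :
    ∀ᵐ x, x ∈ Ioo 0 G.L₀ → DifferentiableAt ℝ du x := by
  filter_upwards [hu.absCont.ae_differentiableAt] with x hx hm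
  exact hx (uIcc_of_le G.L₀_pos.le ▸ Ioo_subset_Icc_self hm)

lemma IsSolution1D.add_smul (h : IsFundamentalPair (κ / G.H) C S)
    (hu : IsSolution1D G κ F γ₁ u du) (a : ℝ) :
    IsSolution1D G κ F γ₁ (fun x => u x + a * S x) (fun x => du x + a * C x) where
  hasDeriv x hx := (hu.hasDeriv x hx).add ((h.hasDerivAt_S x).const_mul a).hasDerivWithinAt
  absCont := hu.absCont.add ((h.absolutelyContinuousOnInterval_C G.L₀_pos.le).const_mul a)
  eqn := by
    filter_upwards [hu.eqn, hu.ae_differentiableAt] with x hx hdiff hm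
    have e : deriv (fun x => du x + a * C x) x = deriv du x + a * (κ / G.H * S x) :=
      ((hdiff hm).hasDerivAt.add ((h.hasDerivAt_C x).const_mul a)).deriv
    rw [e, ← hx hm]; ring
  left := by simp [hu.left, h.S_zero]

lemma IsSolution1D.exists_sub_eq_smul (h : IsFundamentalPair (κ / G.H) C S)
    (hu : IsSolution1D G κ F γ₁ u du) (hv : IsSolution1D G κ F γ₁ v dv) :
    ∃ a : ℝ, ∀ x ∈ Icc 0 G.L₀, v x - u x = a * S x ∧ dv x - du x = a * C x := by
  refine eq_mul_of_secondOrder_homogeneous h G.L₀_pos.le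
    (fun x hx => (hv.hasDeriv x hx).sub (hu.hasDeriv x hx)) (hv.absCont.sub hu.absCont) ?_
    (by simp [hu.left, hv.left])
  filter_upwards [hu.eqn, hv.eqn, hu.ae_differentiableAt, hv.ae_differentiableAt]
    with x eu ev hdu hdv hm
  have e : deriv (fun x => dv x - du x) x = deriv dv x - deriv du x :=
    ((hdv hm).hasDerivAt.sub (hdu hm).hasDerivAt).deriv
  rw [e]
  linear_combination eu hm - ev hm

lemma IsSolution1D.sub_eq_robinDatum1D_smul (hlam : 0 < lam) (h : IsFundamentalPair (κ / G.H) C S)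
    (hu : IsSolution1D G κ F γ₁ u du) (hv : IsSolution1D G κ F γ₁ v dv) {x : ℝ}
    (hx : x ∈ Icc 0 G.L₀) :
    let a := (robinDatum1D G lam v dv - robinDatum1D G lam u du) / (C G.L₀ + lam * S G.L₀)
    v x - u x = a * S x ∧ dv x - du x = a * C x := by
  obtain ⟨a, ha⟩ := hu.exists_sub_eq_smul h hv
  have hD : 0 < C G.L₀ + lam * S G.L₀ :=
    add_pos (h.C_pos _) (mul_pos hlam (h.S_pos _ G.L₀_pos))
  obtain ⟨hv₀, hdv₀⟩ := ha G.L₀ ⟨G.L₀_pos.le, le_rfl⟩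
  have : a = (robinDatum1D G lam v dv - robinDatum1D G lam u du) / (C G.L₀ + lam * S G.L₀) := by
    rw [eq_div_iff hD.ne', robinDatum1D, robinDatum1D]
    linear_combination -hdv₀ - lam * hv₀
  exact this ▸ ha x hx

lemma exists_isSolution1D_robinDatum1D_eq (hκ : 0 ≤ κ) (hlam : 0 < lam)
    (hF : MemLp F 2 (volume.restrict G.Ω)) (g : ℝ) :
    ∃ u du, IsSolution1D G κ F γ₁ u du ∧ robinDatum1D G lam u du = g := by
  obtain ⟨C, S, h⟩ := exists_isFundamentalPair (div_nonneg hκ G.H_pos.le)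
  obtain ⟨u, du, hu⟩ := exists_isSolution1D (γ₁ := γ₁) hκ hF
  have hD : 0 < C G.L₀ + lam * S G.L₀ :=
    add_pos (h.C_pos _) (mul_pos hlam (h.S_pos _ G.L₀_pos))
  refine ⟨_, _, hu.add_smul h ((g - robinDatum1D G lam u du) / (C G.L₀ + lam * S G.L₀)), ?_⟩
  simp only [robinDatum1D]
  field_simp
  ring

/-- `T` is the Robin reflection map of the 1-D model: a solution that takes in the datum
`g = u' + lam u` at `x = L₀` gives out the datum `T g = -u' + lam u`. -/
def IsReflection1D (G : Geometry) (κ lam : ℝ) (F γ₁ : Plane → ℝ) (T : ℝ → ℝ) : Prop :=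
  ∀ u du, IsSolution1D G κ F γ₁ u du → robinDatum2D G lam u du = T (robinDatum1D G lam u du)

/-- Changing the incoming datum by `δ` changes the outgoing one by
`δ (lam S - C) / (lam S + C)`, where `C, S > 0` are taken at `L₀`. -/
lemma exists_isReflection1D (hκ : 0 ≤ κ) (hlam : 0 < lam)
    (hF : MemLp F 2 (volume.restrict G.Ω)) :
    ∃ (ρ : ℝ≥0) (T : ℝ → ℝ), ρ < 1 ∧ LipschitzWith ρ T ∧ IsReflection1D G κ lam F γ₁ T := by
  obtain ⟨C, S, h⟩ := exists_isFundamentalPair (div_nonneg hκ G.H_pos.le)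
  obtain ⟨u, du, hu⟩ := exists_isSolution1D (γ₁ := γ₁) hκ hF
  have hC := h.C_pos G.L₀
  have hS : 0 < lam * S G.L₀ := mul_pos hlam (h.S_pos _ G.L₀_pos)
  set ρ := (lam * S G.L₀ - C G.L₀) / (lam * S G.L₀ + C G.L₀) with hρ
  have hρ_lt : ‖ρ‖₊ < 1 := by
    rw [← NNReal.coe_lt_coe, coe_nnnorm, Real.norm_eq_abs, NNReal.coe_one, abs_lt, hρ]
    exact ⟨by rw [lt_div_iff₀ (by positivity)]; linarith,
      by rw [div_lt_iff₀ (by positivity)]; linarith⟩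
  refine ⟨‖ρ‖₊, fun g => robinDatum2D G lam u du + ρ * (g - robinDatum1D G lam u du), hρ_lt,
    LipschitzWith.of_dist_le_mul fun g g' => ?_, fun v dv hv => ?_⟩
  · rw [Real.dist_eq, Real.dist_eq, coe_nnnorm, Real.norm_eq_abs, ← abs_mul]
    exact le_of_eq (congrArg _ (by ring))
  · obtain ⟨hv₀, hdv₀⟩ := hu.sub_eq_robinDatum1D_smul hlam h hv ⟨G.L₀_pos.le, le_rfl⟩
    rw [← sub_eq_iff_eq_add']
    calc robinDatum2D G lam v dv - robinDatum2D G lam u du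
        = -(dv G.L₀ - du G.L₀) + lam * (v G.L₀ - u G.L₀) := by simp only [robinDatum2D]; ring
      _ = ρ * (robinDatum1D G lam v dv - robinDatum1D G lam u du) := by
        rw [hdv₀, hv₀, hρ]; ring

lemma convergesH1Interval_of_tendsto_robinDatum1D (hκ : 0 ≤ κ) (hlam : 0 < lam)
    {w dw : ℕ → ℝ → ℝ} (hw : ∀ᶠ k in atTop, IsSolution1D G κ F γ₁ (w k) (dw k))
    (hu : IsSolution1D G κ F γ₁ u du)
    (h : Tendsto (fun k => robinDatum1D G lam (w k) (dw k)) atTop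
      (𝓝 (robinDatum1D G lam u du))) :
    ConvergesH1Interval G.L₀ w dw u du := by
  obtain ⟨C, S, hCS⟩ := exists_isFundamentalPair (div_nonneg hκ G.H_pos.le)
  set a : ℕ → ℝ := fun k =>
    (robinDatum1D G lam (w k) (dw k) - robinDatum1D G lam u du) / (C G.L₀ + lam * S G.L₀)
  have ha : Tendsto a atTop (𝓝 0) := by
    simpa using (h.sub_const (robinDatum1D G lam u du)).div_const (C G.L₀ + lam * S G.L₀)
  have hlim {g : ℝ → ℝ} (hg : Continuous g) {f : ℕ → ℝ → ℝ}
      (hf : ∀ᶠ k in atTop, ∀ x ∈ Ioo 0 G.L₀, f k x = a k • g x) :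
      Tendsto (fun k => eLpNorm (f k) 2 (volume.restrict (Ioo 0 G.L₀))) atTop (𝓝 0) := by
    have hgL := memLp_restrict_of_continuous (μ := volume) hg
      (measurableSet_Ioo (a := 0) (b := G.L₀)) (Metric.isBounded_Ioo _ _) measure_Ioo_lt_top.ne 2
    refine Tendsto.congr' (hf.mono fun k hk =>
      (eLpNorm_eq_of_eqOn_smul measurableSet_Ioo hk 2).symm) ?_
    simpa using ENNReal.Tendsto.mul_const ha.enorm (Or.inr hgL.eLpNorm_ne_top)
  exact ⟨hlim hCS.continuous_S (hw.mono fun k hk x hx =>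
      (hu.sub_eq_robinDatum1D_smul hlam hCS hk (Ioo_subset_Icc_self hx)).1),
    hlim hCS.continuous_C (hw.mono fun k hk x hx =>
      (hu.sub_eq_robinDatum1D_smul hlam hCS hk (Ioo_subset_Icc_self hx)).2)⟩

end

/-! ### Square integrals along segments and translations -/

lemma sq_lintegral_le {α : Type*} [MeasurableSpace α] {μ : Measure α} {f : α → ℝ≥0∞}
    (hf : AEMeasurable f μ) : (∫⁻ x, f x ∂μ) ^ 2 ≤ μ univ * ∫⁻ x, f x ^ 2 ∂μ := by
  have h := ENNReal.lintegral_mul_le_Lp_mul_Lq μ Real.HolderConjugate.two_two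
    (f := fun _ => 1) (g := f) aemeasurable_const hf
  simp only [Pi.mul_apply, one_mul, ENNReal.rpow_two, one_pow, lintegral_one] at h
  calc (∫⁻ x, f x ∂μ) ^ 2 ≤ (μ univ ^ (1 / 2 : ℝ) * (∫⁻ x, f x ^ 2 ∂μ) ^ (1 / 2 : ℝ)) ^ 2 := by
        gcongr
    _ = _ := by
        rw [mul_pow, ← ENNReal.rpow_natCast, ← ENNReal.rpow_natCast, ← ENNReal.rpow_mul,
          ← ENNReal.rpow_mul]
        norm_num

lemma enorm_sq_le_two_mul_add {E : Type*} [NormedAddCommGroup E] (a b : E) :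
    ‖a‖ₑ ^ 2 ≤ 2 * ‖b‖ₑ ^ 2 + 2 * ‖b - a‖ₑ ^ 2 := by
  have h : ‖a‖₊ ≤ ‖b‖₊ + ‖b - a‖₊ := by
    simpa using nnnorm_sub_le b (b - a)
  simp only [enorm_eq_nnnorm]
  norm_cast
  calc ‖a‖₊ ^ 2 ≤ (‖b‖₊ + ‖b - a‖₊) ^ 2 := by gcongr
    _ ≤ 2 * (‖b‖₊ ^ 2 + ‖b - a‖₊ ^ 2) := add_sq_le
    _ = _ := mul_add _ _ _

section Segment

variable {V : Type*} [NormedAddCommGroup V] [InnerProductSpace ℝ V] [CompleteSpace V] {φ : V → ℝ}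

lemma continuous_gradient (hφ : ContDiff ℝ 1 φ) : Continuous (gradient φ) :=
  (InnerProductSpace.toDual ℝ V).symm.continuous.comp (hφ.continuous_fderiv one_ne_zero)

lemma sub_eq_integral_inner_gradient (hφ : ContDiff ℝ 1 φ) (x n : V) (s : ℝ) :
    φ (x + s • n) - φ x = ∫ t in (0 : ℝ)..s, inner ℝ (gradient φ (x + t • n)) n := by
  have hd (t : ℝ) : HasDerivAt (fun t : ℝ => φ (x + t • n))
      (inner ℝ (gradient φ (x + t • n)) n) t := by
    have hline : HasDerivAt (fun t : ℝ => x + t • n) n t := by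
      simpa using ((hasDerivAt_id t).smul_const n).const_add x
    have h := ((hφ.differentiable one_ne_zero) (x + t • n)).hasFDerivAt.comp_hasDerivAt t hline
    rwa [← inner_gradient_left] at h
  have hc : Continuous fun t : ℝ => inner ℝ (gradient φ (x + t • n)) n :=
    ((continuous_gradient hφ).comp (by fun_prop)).inner continuous_const
  simpa using (intervalIntegral.integral_eq_sub_of_hasDerivAt (a := 0) (b := s) (fun t _ => hd t)
    (hc.intervalIntegrable _ _)).symm

lemma enorm_sub_sq_le_lintegral_gradient (hφ : ContDiff ℝ 1 φ) (x n : V) {s τ : ℝ}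
    (hs : s ∈ Icc 0 τ) :
    ‖φ (x + s • n) - φ x‖ₑ ^ 2 ≤
      ENNReal.ofReal τ * ‖n‖ₑ ^ 2 * ∫⁻ t in Ioc 0 τ, ‖gradient φ (x + t • n)‖ₑ ^ 2 := by
  have hgc : Continuous fun t : ℝ => gradient φ (x + t • n) :=
    (continuous_gradient hφ).comp (by fun_prop)
  rw [sub_eq_integral_inner_gradient hφ, intervalIntegral.integral_of_le hs.1]
  calc ‖∫ t in Ioc 0 s, inner ℝ (gradient φ (x + t • n)) n‖ₑ ^ 2
      ≤ (∫⁻ t in Ioc 0 τ, ‖gradient φ (x + t • n)‖ₑ * ‖n‖ₑ) ^ 2 := by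
        gcongr
        refine (enorm_integral_le_lintegral_enorm _).trans ?_
        refine (lintegral_mono fun t => ?_).trans (lintegral_mono_set (Ioc_subset_Ioc_right hs.2))
        simp only [enorm_eq_nnnorm]
        exact_mod_cast nnnorm_inner_le_nnnorm _ _
    _ ≤ ENNReal.ofReal τ * ∫⁻ t in Ioc 0 τ, (‖gradient φ (x + t • n)‖ₑ * ‖n‖ₑ) ^ 2 := by
        simpa using sq_lintegral_le (μ := volume.restrict (Ioc 0 τ))
          (hgc.enorm.measurable.mul_const ‖n‖ₑ).aemeasurable
    _ = _ := by
        simp only [mul_pow]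
        rw [lintegral_mul_const' _ _ (by simp)]
        ring

lemma enorm_sq_start_le (hφ : ContDiff ℝ 1 φ) (x n : V) {s τ : ℝ} (hs : s ∈ Icc 0 τ) :
    ‖φ x‖ₑ ^ 2 ≤ 2 * ‖φ (x + s • n)‖ₑ ^ 2 +
      2 * (ENNReal.ofReal τ * ‖n‖ₑ ^ 2 * ∫⁻ t in Ioc 0 τ, ‖gradient φ (x + t • n)‖ₑ ^ 2) := by
  grw [enorm_sq_le_two_mul_add (φ x) (φ (x + s • n)), enorm_sub_sq_le_lintegral_gradient hφ x n hs]

lemma enorm_sq_end_le (hφ : ContDiff ℝ 1 φ) (x n : V) {s τ : ℝ} (hs : s ∈ Icc 0 τ) :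
    ‖φ (x + s • n)‖ₑ ^ 2 ≤ 2 * ‖φ x‖ₑ ^ 2 +
      2 * (ENNReal.ofReal τ * ‖n‖ₑ ^ 2 * ∫⁻ t in Ioc 0 τ, ‖gradient φ (x + t • n)‖ₑ ^ 2) := by
  grw [enorm_sq_le_two_mul_add (φ (x + s • n)) (φ x), enorm_sub_rev (φ x),
    enorm_sub_sq_le_lintegral_gradient hφ x n hs]

lemma mul_enorm_sq_start_le_setLIntegral (hφ : ContDiff ℝ 1 φ) (x n : V) (τ : ℝ) :
    ENNReal.ofReal τ * ‖φ x‖ₑ ^ 2 ≤ 2 * (∫⁻ t in Ioc 0 τ, ‖φ (x + t • n)‖ₑ ^ 2) +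
      2 * ENNReal.ofReal τ ^ 2 * ‖n‖ₑ ^ 2 *
        ∫⁻ t in Ioc 0 τ, ‖gradient φ (x + t • n)‖ₑ ^ 2 := by
  have h := setLIntegral_mono' (μ := volume) measurableSet_Ioc fun t (ht : t ∈ Ioc 0 τ) =>
    enorm_sq_start_le hφ x n (Ioc_subset_Icc_self ht)
  rw [lintegral_add_right _ measurable_const, lintegral_const_mul' _ _ (by simp)] at h
  simp only [setLIntegral_const, Real.volume_Ioc, sub_zero] at h
  rw [mul_comm]
  exact h.trans_eq (by ring)

lemma setLIntegral_enorm_sq_le_start (hφ : ContDiff ℝ 1 φ) (x n : V) (τ : ℝ) :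
    ∫⁻ t in Ioc 0 τ, ‖φ (x + t • n)‖ₑ ^ 2 ≤ 2 * ENNReal.ofReal τ * ‖φ x‖ₑ ^ 2 +
      2 * ENNReal.ofReal τ ^ 2 * ‖n‖ₑ ^ 2 *
        ∫⁻ t in Ioc 0 τ, ‖gradient φ (x + t • n)‖ₑ ^ 2 := by
  have h := setLIntegral_mono' (μ := volume) measurableSet_Ioc fun t (ht : t ∈ Ioc 0 τ) =>
    enorm_sq_end_le hφ x n (Ioc_subset_Icc_self ht)
  simp only [setLIntegral_const, Real.volume_Ioc, sub_zero] at h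
  exact h.trans_eq (by ring)

end Segment

section Translation

lemma setLIntegral_comp_add_le {V : Type*} [AddGroup V] [MeasurableSpace V] [MeasurableAdd V]
    {μ : Measure V} [μ.IsAddRightInvariant] {A B : Set V} (hA : MeasurableSet A)
    (hB : MeasurableSet B) {v : V} (h : ∀ x ∈ A, x + v ∈ B) (g : V → ℝ≥0∞) :
    ∫⁻ x in A, g (x + v) ∂μ ≤ ∫⁻ x in B, g x ∂μ := by
  rw [← lintegral_indicator hA, ← lintegral_indicator hB,
    ← lintegral_add_right_eq_self (B.indicator g) v]
  refine lintegral_mono fun x => ?_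
  by_cases hx : x ∈ A
  · simp [hx, h x hx]
  · simp [hx]

variable {V : Type*} [NormedAddCommGroup V] [InnerProductSpace ℝ V] [CompleteSpace V]
  [MeasurableSpace V] [BorelSpace V] {φ : V → ℝ}
  {μ : Measure V} [μ.IsAddRightInvariant] [SFinite μ]

lemma setLIntegral_enorm_sq_le_of_translate (hφ : ContDiff ℝ 1 φ) {A B D : Set V}
    (hA : MeasurableSet A) (hB : MeasurableSet B) (hD : MeasurableSet D) {v : V}
    (hAB : ∀ x ∈ A, x + v ∈ B) (hAD : ∀ x ∈ A, ∀ t ∈ Ioc (0 : ℝ) 1, x + t • v ∈ D) :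
    ∫⁻ x in A, ‖φ x‖ₑ ^ 2 ∂μ ≤
      2 * (∫⁻ x in B, ‖φ x‖ₑ ^ 2 ∂μ) + 2 * ‖v‖ₑ ^ 2 * ∫⁻ x in D, ‖gradient φ x‖ₑ ^ 2 ∂μ := by
  have hgrad : Measurable fun q : V × ℝ => ‖gradient φ (q.1 + q.2 • v)‖ₑ ^ 2 :=
    ((continuous_gradient hφ).comp
      (by fun_prop : Continuous fun q : V × ℝ => q.1 + q.2 • v)).enorm.measurable.pow_const 2
  have hshift : Measurable fun x => 2 * ‖φ (x + v)‖ₑ ^ 2 :=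
    ((hφ.continuous.comp (continuous_add_const v)).enorm.measurable.pow_const 2).const_mul 2
  calc ∫⁻ x in A, ‖φ x‖ₑ ^ 2 ∂μ
      ≤ ∫⁻ x in A, (2 * ‖φ (x + v)‖ₑ ^ 2 +
          2 * ‖v‖ₑ ^ 2 * ∫⁻ t in Ioc (0 : ℝ) 1, ‖gradient φ (x + t • v)‖ₑ ^ 2) ∂μ :=
        lintegral_mono fun x => by
          simpa [mul_assoc] using enorm_sq_start_le hφ x v (s := 1) (τ := 1) (by simp)
    _ = 2 * (∫⁻ x in A, ‖φ (x + v)‖ₑ ^ 2 ∂μ) + 2 * ‖v‖ₑ ^ 2 *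
          ∫⁻ t in Ioc (0 : ℝ) 1, ∫⁻ x in A, ‖gradient φ (x + t • v)‖ₑ ^ 2 ∂μ := by
        rw [lintegral_add_left hshift, lintegral_const_mul' _ _ (by simp),
          lintegral_const_mul' _ _ (by finiteness), lintegral_lintegral_swap hgrad.aemeasurable]
    _ ≤ 2 * (∫⁻ x in B, ‖φ x‖ₑ ^ 2 ∂μ) + 2 * ‖v‖ₑ ^ 2 *
          ∫⁻ _t in Ioc (0 : ℝ) 1, ∫⁻ x in D, ‖gradient φ x‖ₑ ^ 2 ∂μ := by
        gcongr 2 * ?_ + 2 * ‖v‖ₑ ^ 2 * ?_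
        · exact setLIntegral_comp_add_le hA hB hAB fun x => ‖φ x‖ₑ ^ 2
        · exact setLIntegral_mono measurable_const fun t ht => setLIntegral_comp_add_le hA hD
            (fun x hx => hAD x hx t ht) fun x => ‖gradient φ x‖ₑ ^ 2
    _ = _ := by simp

end Translation

/-! ### Domination of `L²` norms by a functional -/

/-- The `L²(μ)` norm of smooth functions is dominated by the functional `E`. With `E` the square of
the `H¹(D)` norm this is a trace inequality when `μ` is the surface measure, and with `E` a
weaker energy it is a Poincaré inequality when `μ` is the volume. -/
def Controlled {V : Type*} [NormedAddCommGroup V] [NormedSpace ℝ V] [MeasurableSpace V]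
    (E : (V → ℝ) → ℝ≥0∞) (μ : Measure V) : Prop :=
  ∃ c : ℝ≥0, ∀ φ : V → ℝ, ContDiff ℝ 1 φ → ∫⁻ x, ‖φ x‖ₑ ^ 2 ∂μ ≤ c * E φ

namespace Controlled

section

variable {V : Type*} [NormedAddCommGroup V] [NormedSpace ℝ V] [MeasurableSpace V]
  {E : (V → ℝ) → ℝ≥0∞} {μ ν : Measure V} {A B K : Set V}

lemma mono (hν : Controlled E ν) (h : μ ≤ ν) : Controlled E μ := by
  obtain ⟨c, hc⟩ := hν
  exact ⟨c, fun φ hφ => (lintegral_mono' h le_rfl).trans (hc φ hφ)⟩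

lemma smul (hμ : Controlled E μ) (a : ℝ≥0) : Controlled E (a • μ) := by
  obtain ⟨c, hc⟩ := hμ
  refine ⟨a * c, fun φ hφ => ?_⟩
  rw [lintegral_smul_measure, ENNReal.coe_mul, mul_assoc]
  exact mul_le_mul_right (hc φ hφ) _

lemma mono_set (hB : Controlled E (μ.restrict B)) (h : A ⊆ B) : Controlled E (μ.restrict A) :=
  hB.mono (Measure.restrict_mono_set μ h)

lemma union (hA : Controlled E (μ.restrict A)) (hB : Controlled E (μ.restrict B)) :
    Controlled E (μ.restrict (A ∪ B)) := by
  obtain ⟨a, ha⟩ := hA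
  obtain ⟨b, hb⟩ := hB
  refine ⟨a + b, fun φ hφ => (lintegral_union_le _ _ _).trans ?_⟩
  rw [ENNReal.coe_add, add_mul]
  exact add_le_add (ha φ hφ) (hb φ hφ)

lemma of_isCompact (hK : IsCompact K)
    (h : ∀ x ∈ K, ∃ U ∈ 𝓝 x, Controlled E (μ.restrict (U ∩ A))) :
    Controlled E (μ.restrict (K ∩ A)) := by
  refine hK.induction_on (p := fun s => Controlled E (μ.restrict (s ∩ A))) ⟨0, by simp⟩
    (fun s t hst ht => ht.mono_set (inter_subset_inter_left _ hst))
    (fun s t hs ht => by rw [union_inter_distrib_right]; exact hs.union ht) fun x hx => ?_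
  obtain ⟨U, hU, hc⟩ := h x hx
  exact ⟨U, mem_nhdsWithin_of_mem_nhds hU, hc⟩

end

variable {V : Type*} [NormedAddCommGroup V] [InnerProductSpace ℝ V] [CompleteSpace V]
  [MeasurableSpace V] [BorelSpace V] {E : (V → ℝ) → ℝ≥0∞}
  {μ : Measure V} [μ.IsAddRightInvariant] [SFinite μ] {A B D : Set V}

lemma translate (hE : ∀ φ, ∫⁻ x in D, ‖gradient φ x‖ₑ ^ 2 ∂μ ≤ E φ) (hA : MeasurableSet A)
    (hB : MeasurableSet B) (hD : MeasurableSet D) {v : V}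
    (hAB : ∀ x ∈ A, x + v ∈ B) (hAD : ∀ x ∈ A, ∀ t ∈ Ioc (0 : ℝ) 1, x + t • v ∈ D)
    (h : Controlled E (μ.restrict B)) : Controlled E (μ.restrict A) := by
  obtain ⟨c, hc⟩ := h
  refine ⟨2 * c + 2 * ‖v‖₊ ^ 2, fun φ hφ =>
    (setLIntegral_enorm_sq_le_of_translate hφ hA hB hD hAB hAD).trans ?_⟩
  push_cast
  grw [hc φ hφ, hE φ, enorm_eq_nnnorm, add_mul]
  simp only [mul_assoc, le_refl]

/-- If `y` is close to a point `w` around which `E` controls the `L²` norm, then a small ball around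
`y` can be moved inside `D` to that neighbourhood of `w`. -/
lemma exists_nhds_of_mem_closure (hE : ∀ φ, ∫⁻ x in D, ‖gradient φ x‖ₑ ^ 2 ∂μ ≤ E φ)
    (hD : IsOpen D) {y : V} (hyD : y ∈ D)
    (hy : y ∈ closure {x | ∃ U ∈ 𝓝 x, Controlled E (μ.restrict U)}) :
    ∃ U ∈ 𝓝 y, Controlled E (μ.restrict U) := by
  obtain ⟨ε, hε, hball⟩ := Metric.isOpen_iff.1 hD y hyD
  obtain ⟨w, ⟨U, hU, hc⟩, hyw⟩ := Metric.mem_closure_iff.1 hy (ε / 2) (by positivity)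
  obtain ⟨δ, hδ, hδU⟩ := Metric.mem_nhds_iff.1 hU
  refine ⟨Metric.ball y (min δ (ε / 2)), Metric.ball_mem_nhds _ (by positivity),
    translate (B := Metric.ball w δ) (v := w - y) hE measurableSet_ball measurableSet_ball
      hD.measurableSet (fun z hz => ?_) (fun z hz t ht => hball ?_) (hc.mono_set hδU)⟩
  · rw [mem_ball_iff_norm] at hz ⊢
    rw [show z + (w - y) - w = z - y by abel]
    exact hz.trans_le (min_le_left _ _)
  · rw [mem_ball_iff_norm] at hz ⊢
    rw [dist_eq_norm'] at hyw
    calc ‖z + t • (w - y) - y‖ = ‖(z - y) + t • (w - y)‖ := by congr 1; abel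
      _ ≤ ‖z - y‖ + t * ‖w - y‖ := by
        grw [norm_add_le, norm_smul, Real.norm_of_nonneg ht.1.le]
      _ < ε / 2 + ε / 2 := by
        have := hz.trans_le (min_le_right _ _)
        nlinarith [norm_nonneg (w - y), ht.2]
      _ = ε := by ring

lemma exists_nhds_of_isConnected (hE : ∀ φ, ∫⁻ x in D, ‖gradient φ x‖ₑ ^ 2 ∂μ ≤ E φ)
    (hD : IsOpen D) (hconn : IsConnected D) {U : Set V} (hU : IsOpen U) (hDU : (D ∩ U).Nonempty)
    (hUc : Controlled E (μ.restrict U)) {x : V} (hx : x ∈ D) :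
    ∃ W ∈ 𝓝 x, Controlled E (μ.restrict W) := by
  have hopen : IsOpen {x | ∃ W ∈ 𝓝 x, Controlled E (μ.restrict W)} := by
    rw [isOpen_iff_mem_nhds]
    rintro y ⟨W, hW, hc⟩
    filter_upwards [eventually_mem_nhds_iff.2 hW] with z hz using ⟨W, hz, hc⟩
  exact hconn.isPreconnected.subset_of_closure_inter_subset hopen
    (hDU.mono (inter_subset_inter_right _ fun y hy => ⟨U, hU.mem_nhds hy, hUc⟩))
    (fun y ⟨hy, hyD⟩ => exists_nhds_of_mem_closure hE hD hyD hy) hx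

end Controlled

/-! ### Coordinates above a graph -/

section GraphChart

/-- The plane in coordinates `(s, t)`, where `s` is the abscissa in the orthonormal frame given by
`p` and `e`, and `t` is the height above the graph of `ψ` in this frame. It straightens a boundary
that is locally the graph of `ψ`. -/
def graphChart (e : Plane ≃ₗᵢ[ℝ] Plane) (p : Plane) (ψ : C(ℝ, ℝ)) : ℝ × ℝ ≃ₜ Plane :=
  (Homeomorph.mk
    { toFun := fun q => (q.1, ψ q.1 + q.2)
      invFun := fun q => (q.1, -ψ q.1 + q.2)
      left_inv := fun q => by simp
      right_inv := fun q => by simp }).trans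
    (ptHomeo.trans (e.toHomeomorph.trans (Homeomorph.addLeft p)))

variable (e : Plane ≃ₗᵢ[ℝ] Plane) (p : Plane) (ψ : C(ℝ, ℝ))

lemma graphChart_apply (s t : ℝ) : graphChart e p ψ (s, t) = p + e (pt s (ψ s + t)) :=
  congrArg (fun x => p + e x) (ptHomeo_apply (s, ψ s + t))

lemma graphChart_add_smul (s t c : ℝ) :
    graphChart e p ψ (s, t) + c • e (pt 0 1) = graphChart e p ψ (s, t + c) := by
  rw [graphChart_apply, graphChart_apply, ← map_smul, add_assoc, ← map_add, smul_pt, pt_add]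
  simp [add_assoc]

lemma measurePreserving_graphChart : MeasurePreserving (graphChart e p ψ) := by
  have hshear : MeasurePreserving fun q : ℝ × ℝ => (q.1, ψ q.1 + q.2) :=
    (MeasurePreserving.id volume).skew_product (by fun_prop)
      (ae_of_all _ fun s => map_add_left_eq_self volume (ψ s))
  exact (measurePreserving_add_left volume p).comp
    (e.measurePreserving.comp (measurePreserving_ptHomeo.comp hshear))

lemma setLIntegral_graphChart_image {f : Plane → ℝ≥0∞} (hf : Measurable f) {I J : Set ℝ} :
    ∫⁻ x in graphChart e p ψ '' (I ×ˢ J), f x =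
      ∫⁻ s in I, ∫⁻ t in J, f (graphChart e p ψ (s, 0) + t • e (pt 0 1)) := by
  have hemb := (graphChart e p ψ).measurableEmbedding
  rw [← (measurePreserving_graphChart e p ψ).setLIntegral_comp_emb hemb, Measure.volume_eq_prod,
    ← Measure.prod_restrict, lintegral_prod _ (by fun_prop)]
  simp only [graphChart_add_smul, zero_add]

variable {e p ψ} {φ : Plane → ℝ} {I : Set ℝ}

lemma setLIntegral_graph_le (hφ : ContDiff ℝ 1 φ) (τ : ℝ) :
    ENNReal.ofReal τ * ∫⁻ s in I, ‖φ (graphChart e p ψ (s, 0))‖ₑ ^ 2 ≤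
      2 * (∫⁻ x in graphChart e p ψ '' (I ×ˢ Ioc 0 τ), ‖φ x‖ₑ ^ 2) + 2 * ENNReal.ofReal τ ^ 2 *
        ∫⁻ x in graphChart e p ψ '' (I ×ˢ Ioc 0 τ), ‖gradient φ x‖ₑ ^ 2 := by
  have hφm : Measurable fun x => ‖φ x‖ₑ ^ 2 := hφ.continuous.enorm.measurable.pow_const 2
  have hgm : Measurable fun x => ‖gradient φ x‖ₑ ^ 2 :=
    (continuous_gradient hφ).enorm.measurable.pow_const 2
  have hint : Measurable fun s =>
      2 * ∫⁻ t in Ioc 0 τ, ‖φ (graphChart e p ψ (s, 0) + t • e (pt 0 1))‖ₑ ^ 2 :=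
    (Measurable.lintegral_prod_right' (f := fun q : ℝ × ℝ =>
      ‖φ (graphChart e p ψ (q.1, 0) + q.2 • e (pt 0 1))‖ₑ ^ 2)
        (hφm.comp (by fun_prop))).const_mul 2
  rw [setLIntegral_graphChart_image e p ψ hφm, setLIntegral_graphChart_image e p ψ hgm,
    ← lintegral_const_mul' _ _ (by simp), ← lintegral_const_mul' _ _ (by simp),
    ← lintegral_const_mul' _ _ (by finiteness),
    ← lintegral_add_left hint]
  exact lintegral_mono fun s => by
    simpa [enorm_pt_zero_one] using
      mul_enorm_sq_start_le_setLIntegral hφ (graphChart e p ψ (s, 0)) (e (pt 0 1)) τ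

lemma setLIntegral_strip_le (hφ : ContDiff ℝ 1 φ) (τ : ℝ) :
    ∫⁻ x in graphChart e p ψ '' (I ×ˢ Ioc 0 τ), ‖φ x‖ₑ ^ 2 ≤
      2 * ENNReal.ofReal τ * (∫⁻ s in I, ‖φ (graphChart e p ψ (s, 0))‖ₑ ^ 2) +
        2 * ENNReal.ofReal τ ^ 2 *
          ∫⁻ x in graphChart e p ψ '' (I ×ˢ Ioc 0 τ), ‖gradient φ x‖ₑ ^ 2 := by
  have hφm : Measurable fun x => ‖φ x‖ₑ ^ 2 := hφ.continuous.enorm.measurable.pow_const 2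
  have hgm : Measurable fun x => ‖gradient φ x‖ₑ ^ 2 :=
    (continuous_gradient hφ).enorm.measurable.pow_const 2
  have hgraph : Measurable fun s =>
      2 * ENNReal.ofReal τ * ‖φ (graphChart e p ψ (s, 0))‖ₑ ^ 2 :=
    (hφm.comp (by fun_prop)).const_mul _
  rw [setLIntegral_graphChart_image e p ψ hφm, setLIntegral_graphChart_image e p ψ hgm,
    ← lintegral_const_mul' _ _ (by finiteness), ← lintegral_const_mul' _ _ (by finiteness),
    ← lintegral_add_left hgraph]
  exact lintegral_mono fun s => by
    simpa [enorm_pt_zero_one] using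
      setLIntegral_enorm_sq_le_start hφ (graphChart e p ψ (s, 0)) (e (pt 0 1)) τ

end GraphChart

/-! ### Lipschitz domains -/

lemma eq_of_mem_frontier {X : Type*} [TopologicalSpace X] {D O : Set X} (hO : IsOpen O)
    {f g : X → ℝ} (hf : Continuous f) (hg : Continuous g) (h : ∀ q ∈ O, q ∈ D ↔ f q < g q) {q : X}
    (hq : q ∈ O) (hqD : q ∈ frontier D) : f q = g q := by
  have hDO : D ∩ O = {b | f b < g b} ∩ O := by
    ext x
    exact and_congr_left (h x)
  have hmem : q ∈ frontier {b | f b < g b} ∩ O := by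
    rw [← frontier_inter_open_inter hO, ← hDO, frontier_inter_open_inter hO]
    exact ⟨hqD, hq⟩
  exact frontier_lt_subset_eq hf hg hmem.1

lemma exists_graphChart {D : Set Plane} (hL : HasLipschitzBoundary D) {p : Plane}
    (hp : p ∈ frontier D) :
    ∃ (e : Plane ≃ₗᵢ[ℝ] Plane) (K : ℝ≥0) (ψ : C(ℝ, ℝ)) (a τ : ℝ), 0 < a ∧ 0 < τ ∧
      LipschitzWith K ψ ∧ graphChart e p ψ (0, 0) = p ∧
      ∀ s t, |s| ≤ a → |t| ≤ 2 * τ → (graphChart e p ψ (s, t) ∈ D ↔ 0 < t) := by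
  obtain ⟨e, r, h, K, ψ, hr, hh, hψ, _, hiff⟩ := hL p hp
  have hψ0 : ψ 0 = 0 := by
    have hbox : IsOpen {q : ℝ × ℝ | |q.1| < r ∧ |q.2| < h} :=
      (isOpen_lt continuous_fst.abs continuous_const).inter
        (isOpen_lt continuous_snd.abs continuous_const)
    refine eq_of_mem_frontier (D := graphChart e p 0 ⁻¹' D) (q := (0, 0)) hbox
      (hψ.continuous.comp continuous_fst) continuous_snd (fun q hq => ?_) (by simp [hr, hh]) ?_
    · rw [← Prod.mk.eta (p := q), mem_preimage, graphChart_apply]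
      simpa using hiff q.1 q.2 hq.1 hq.2
    · rw [← Homeomorph.preimage_frontier, mem_preimage, graphChart_apply]
      simpa [pt_zero] using hp
  obtain ⟨δ, hδ, hδψ⟩ := Metric.continuousAt_iff.1 (hψ.continuous.continuousAt (x := 0)) (h / 2)
    (by positivity)
  simp only [hψ0, Real.dist_eq, sub_zero] at hδψ
  refine ⟨e, K, ⟨ψ, hψ.continuous⟩, min (r / 2) (δ / 2), h / 6, by positivity, by positivity, hψ,
    ?_, fun s t hs ht => ?_⟩
  · simp [graphChart_apply, hψ0, pt_zero]
  · have hsr := hs.trans (min_le_left _ _)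
    have hsψ := hδψ (x := s) (by linarith [hs.trans (min_le_right _ _)])
    rw [graphChart_apply, ContinuousMap.coe_mk, hiff s _ (by linarith)
      (by linarith [abs_add_le (ψ s) t])]
    exact lt_add_iff_pos_right _

lemma exists_inward_shift {D : Set Plane} (hL : HasLipschitzBoundary D) {p : Plane}
    (hp : p ∈ frontier D) :
    ∃ (U K : Set Plane) (v : Plane), IsOpen U ∧ p ∈ U ∧ IsCompact K ∧ K ⊆ D ∧
      ∀ x ∈ U ∩ D, x + v ∈ K ∧ ∀ t ∈ Ioc (0 : ℝ) 1, x + t • v ∈ D := by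
  obtain ⟨e, -, ψ, a, τ, ha, hτ, -, hp0, hD⟩ := exists_graphChart hL hp
  refine ⟨graphChart e p ψ '' (Ioo (-a) a ×ˢ Ioo (-τ) τ),
    graphChart e p ψ '' (Icc (-a) a ×ˢ Icc τ (2 * τ)), τ • e (pt 0 1),
    (graphChart e p ψ).isOpenMap _ (isOpen_Ioo.prod isOpen_Ioo),
    ⟨(0, 0), by simp [ha, hτ], hp0⟩,
    (isCompact_Icc.prod isCompact_Icc).image (graphChart e p ψ).continuous, ?_, ?_⟩
  · rintro _ ⟨⟨s, t⟩, ⟨hs, ht⟩, rfl⟩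
    exact (hD s t (abs_le.2 hs) (abs_le.2 ⟨by linarith [ht.1], ht.2⟩)).2 (hτ.trans_le ht.1)
  · rintro _ ⟨⟨⟨s, t⟩, ⟨hs, ht⟩, rfl⟩, hxD⟩
    simp only at hs ht
    have hs' : |s| ≤ a := (abs_lt.2 hs).le
    have ht0 : 0 < t := (hD s t hs' (abs_le.2 ⟨by linarith [ht.1], by linarith [ht.2]⟩)).1 hxD
    refine ⟨⟨(s, t + τ), ⟨abs_le.1 hs', by simp [ht0.le], by simp only; linarith [ht.2]⟩,
      (graphChart_add_smul e p ψ s t τ).symm⟩, fun c hc => ?_⟩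
    rw [smul_smul, graphChart_add_smul]
    have hcτ : 0 < c * τ ∧ c * τ ≤ τ := ⟨mul_pos hc.1 hτ, mul_le_of_le_one_left hτ.le hc.2⟩
    exact (hD s _ hs' (abs_le.2 ⟨by linarith, by linarith [ht.2]⟩)).2 (by linarith)

lemma Controlled.of_isConnected {E : (Plane → ℝ) → ℝ≥0∞} {D : Set Plane}
    (hE : ∀ φ, ∫⁻ x in D, ‖gradient φ x‖ₑ ^ 2 ≤ E φ) (hD : IsOpen D)
    (hb : Bornology.IsBounded D) (hL : HasLipschitzBoundary D) (hconn : IsConnected D)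
    {U : Set Plane} (hU : IsOpen U) (hDU : (D ∩ U).Nonempty)
    (hUc : Controlled E (volume.restrict U)) : Controlled E (volume.restrict D) := by
  have hint (x : Plane) (hx : x ∈ D) : ∃ W ∈ 𝓝 x, Controlled E (volume.restrict W) :=
    exists_nhds_of_isConnected hE hD hconn hU hDU hUc hx
  refine (of_isCompact (A := D) hb.isCompact_closure fun x hx => ?_).mono_set
    (subset_inter subset_closure subset_rfl)
  by_cases hxD : x ∈ D
  · obtain ⟨W, hW, hc⟩ := hint x hxD
    exact ⟨W, hW, hc.mono_set inter_subset_left⟩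
  · obtain ⟨W, K, v, hW, hxW, hK, hKD, hWK⟩ := exists_inward_shift hL ⟨hx, by rwa [hD.interior_eq]⟩
    have hKc : Controlled E (volume.restrict (K ∩ univ)) := of_isCompact hK fun y hy => by
      simpa using hint y (hKD hy)
    rw [inter_univ] at hKc
    exact ⟨W, hW.mem_nhds hxW, translate hE (hW.inter hD).measurableSet hK.measurableSet
      hD.measurableSet (fun y hy => (hWK y hy).1) (fun y hy => (hWK y hy).2) hKc⟩

/-- The square of the `H¹(D)` norm. -/
def sobolevEnergy (D : Set Plane) (φ : Plane → ℝ) : ℝ≥0∞ :=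
  (∫⁻ x in D, ‖φ x‖ₑ ^ 2) + ∫⁻ x in D, ‖gradient φ x‖ₑ ^ 2

lemma controlled_map_graph {D : Set Plane} {e : Plane ≃ₗᵢ[ℝ] Plane} {p : Plane} {ψ : C(ℝ, ℝ)}
    {I : Set ℝ} {τ : ℝ} (hτ : 0 < τ) (hD : graphChart e p ψ '' (I ×ˢ Ioc 0 τ) ⊆ D) :
    Controlled (sobolevEnergy D) ((volume.restrict I).map fun s => graphChart e p ψ (s, 0)) := by
  lift τ to ℝ≥0 using hτ.le
  have hτ0 : τ ≠ 0 := by exact_mod_cast hτ.ne'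
  refine ⟨τ⁻¹ * (2 + 2 * τ ^ 2), fun φ hφ => ?_⟩
  have hgraph : Measurable fun s => graphChart e p ψ (s, 0) := by fun_prop
  rw [lintegral_map (hφ.continuous.enorm.measurable.pow_const 2) hgraph, ENNReal.coe_mul,
    ENNReal.coe_inv hτ0, mul_assoc, ← ENNReal.mul_le_iff_le_inv (by simpa) (by simp)]
  push_cast
  grw [← ENNReal.ofReal_coe_nnreal, setLIntegral_graph_le hφ, lintegral_mono_set hD,
    lintegral_mono_set hD, add_mul]
  gcongr
  exacts [le_self_add, le_add_self]

lemma lipschitzWith_graph {e : Plane ≃ₗᵢ[ℝ] Plane} {p : Plane} {ψ : C(ℝ, ℝ)} {K : ℝ≥0}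
    (hψ : LipschitzWith K ψ) : LipschitzWith (1 + K) fun s => graphChart e p ψ (s, 0) := by
  refine LipschitzWith.of_dist_le_mul fun s s' => ?_
  simp only [graphChart_apply, add_zero]
  rw [dist_add_left, e.dist_map, EuclideanSpace.dist_eq, Fin.sum_univ_two]
  simp only [pt_apply_zero, pt_apply_one]
  calc √(dist s s' ^ 2 + dist (ψ s) (ψ s') ^ 2) ≤ √((dist s s' + dist (ψ s) (ψ s')) ^ 2) := by
        gcongr
        nlinarith [dist_nonneg (x := s) (y := s'), dist_nonneg (x := ψ s) (y := ψ s')]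
    _ = dist s s' + dist (ψ s) (ψ s') := Real.sqrt_sq (by positivity)
    _ ≤ (1 + K : ℝ≥0) * dist s s' := by
        push_cast
        linarith [hψ.dist_le_mul s s']

lemma arc_restrict_le_map {g : ℝ → Plane} {c : ℝ≥0} (hg : LipschitzWith c g) {S : Set Plane}
    {I : Set ℝ} (h : S ⊆ g '' I) : arc.restrict S ≤ c • (volume.restrict I).map g := by
  refine Measure.le_iff.2 fun A hA => ?_
  have hgm := hg.continuous.measurable
  rw [Measure.restrict_apply hA, Measure.smul_apply, Measure.map_apply hgm hA,
    Measure.restrict_apply (hgm hA)]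
  calc arc (A ∩ S) ≤ arc (g '' (g ⁻¹' A ∩ I)) := by
        rw [image_preimage_inter]
        gcongr
    _ ≤ c • volume (g ⁻¹' A ∩ I) := by
        have hle := hg.hausdorffMeasure_image_le zero_le_one (g ⁻¹' A ∩ I)
        rwa [hausdorffMeasure_real, ENNReal.rpow_one] at hle

lemma exists_nhds_controlled_frontier {D : Set Plane} (hL : HasLipschitzBoundary D) {p : Plane}
    (hp : p ∈ frontier D) :
    ∃ U ∈ 𝓝 p, Controlled (sobolevEnergy D) (arc.restrict (U ∩ frontier D)) := by
  obtain ⟨e, K, ψ, a, τ, ha, hτ, hψ, hp0, hD⟩ := exists_graphChart hL hp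
  have hbox : IsOpen (Ioo (-a) a ×ˢ Ioo (-τ) τ) := isOpen_Ioo.prod isOpen_Ioo
  have hD' (s t : ℝ) (hs : s ∈ Ioo (-a) a) (ht : t ∈ Ioc (-τ) τ) :
      graphChart e p ψ (s, t) ∈ D ↔ 0 < t :=
    hD s t (abs_lt.2 hs).le (abs_le.2 ⟨by linarith [ht.1], by linarith [ht.2]⟩)
  refine ⟨graphChart e p ψ '' (Ioo (-a) a ×ˢ Ioo (-τ) τ),
    ((graphChart e p ψ).isOpenMap _ hbox).mem_nhds ⟨(0, 0), by simp [ha, hτ], hp0⟩, ?_⟩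
  have hgraph : graphChart e p ψ '' (Ioo (-a) a ×ˢ Ioo (-τ) τ) ∩ frontier D ⊆
      (fun s => graphChart e p ψ (s, 0)) '' Ioo (-a) a := by
    rintro _ ⟨⟨⟨s, t⟩, hst, rfl⟩, hx⟩
    have ht : (0 : ℝ) = t := eq_of_mem_frontier (D := graphChart e p ψ ⁻¹' D) (q := (s, t)) hbox
      continuous_const continuous_snd (fun q hq => hD' q.1 q.2 hq.1 (Ioo_subset_Ioc_self hq.2)) hst
      (by rwa [← Homeomorph.preimage_frontier])
    exact ⟨s, hst.1, by rw [ht]⟩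
  refine Controlled.mono (Controlled.smul (controlled_map_graph hτ ?_) (1 + K))
    (arc_restrict_le_map (lipschitzWith_graph hψ) hgraph)
  rintro _ ⟨⟨s, t⟩, ⟨hs, ht⟩, rfl⟩
  exact (hD' s t hs ⟨by linarith [ht.1], ht.2⟩).2 ht.1

lemma controlled_frontier {D : Set Plane} (hb : Bornology.IsBounded D)
    (hL : HasLipschitzBoundary D) :
    Controlled (sobolevEnergy D) (arc.restrict (frontier D)) := by
  have hcompact : IsCompact (frontier D) :=
    hb.isCompact_closure.of_isClosed_subset isClosed_frontier frontier_subset_closure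
  simpa using Controlled.of_isCompact (A := frontier D) hcompact fun x hx =>
    exists_nhds_controlled_frontier hL hx

lemma arc_frontier_lt_top {D : Set Plane} (hb : Bornology.IsBounded D)
    (hL : HasLipschitzBoundary D) : arc (frontier D) < ⊤ := by
  obtain ⟨c, hc⟩ := controlled_frontier hb hL
  have hone := hc (fun _ => 1) contDiff_const
  simp only [sobolevEnergy, gradient_fun_const', enorm_one, one_pow, lintegral_one,
    Measure.restrict_apply_univ, enorm_zero] at hone
  exact hone.trans_lt (ENNReal.mul_lt_top (by simp) (by simpa using hb.measure_lt_top))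

namespace Geometry

variable (G : Geometry)

lemma isOpen_Ω₂ : IsOpen G.Ω₂ := G.isOpen.inter (isOpen_lt continuous_const (by fun_prop))

lemma isBounded_Ω₂ : Bornology.IsBounded G.Ω₂ := G.bounded.subset inter_subset_left

lemma mem_Ω₂_iff {p : Plane} (hp : p 0 < G.L₂) :
    p ∈ G.Ω₂ ↔ G.L₀ < p 0 ∧ 0 < p 1 ∧ p 1 < G.H := by
  simp only [Ω₂, mem_inter_iff, G.thin p hp, mem_ofPred_eq]
  exact ⟨fun h => ⟨h.2, h.1.2⟩, fun h => ⟨⟨G.L₀_pos.trans h.1, h.2⟩, h.1⟩⟩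

lemma Γ_subset_Ω : G.Γ ⊆ G.Ω := fun p hp =>
  (G.thin p (hp.1.trans_lt G.L₀_lt)).2 ⟨by rw [hp.1]; exact G.L₀_pos, hp.2⟩

/-- The Dirichlet energy on `Ω₂` plus the square of the `L²` norm on the interface. -/
def energy (φ : Plane → ℝ) : ℝ≥0∞ :=
  (∫⁻ x in G.Ω₂, ‖gradient φ x‖ₑ ^ 2) + ∫⁻ x in G.Γ, ‖φ x‖ₑ ^ 2 ∂arc

/-- Coordinates near the interface: `(z, t)` stands for the point `(L₀ + t, z)`. -/
def interfaceChart : ℝ × ℝ ≃ₜ Plane :=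
  graphChart (LinearIsometryEquiv.piLpCongrLeft 2 ℝ ℝ (Equiv.swap 0 1)) (pt G.L₀ 0) 0

lemma interfaceChart_apply (z t : ℝ) : G.interfaceChart (z, t) = pt (G.L₀ + t) z := by
  rw [interfaceChart, graphChart_apply]
  ext i
  fin_cases i <;> simp [LinearIsometryEquiv.piLpCongrLeft_apply]

lemma interfaceChart_image_subset {τ : ℝ} (hτ : τ < G.L₂ - G.L₀) :
    G.interfaceChart '' (Ioo 0 G.H ×ˢ Ioc 0 τ) ⊆ G.Ω₂ := by
  rintro _ ⟨⟨z, t⟩, ⟨hz, ht⟩, rfl⟩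
  simp only at hz ht
  rw [interfaceChart_apply, mem_Ω₂_iff]
  · simpa using ⟨ht.1, hz⟩
  · rw [pt_apply_zero]
    linarith [ht.2]

lemma Γ_subset_frontier : G.Γ ⊆ frontier G.Ω₂ := by
  intro p hp
  refine ⟨?_, fun h => lt_irrefl G.L₀ (hp.1 ▸ (interior_subset h).2)⟩
  have hlim : Tendsto (fun t => G.interfaceChart (p 1, t)) (𝓝[>] 0) (𝓝 p) := by
    have hp0 : G.interfaceChart (p 1, 0) = p := by
      rw [interfaceChart_apply, add_zero, ← hp.1, pt_eta]
    nth_rewrite 2 [← hp0]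
    exact ((by fun_prop : Continuous fun t => G.interfaceChart (p 1, t)).tendsto 0).mono_left
      nhdsWithin_le_nhds
  obtain ⟨τ, hτ, hτ'⟩ := exists_between (sub_pos.2 G.L₀_lt)
  refine mem_closure_of_tendsto hlim ?_
  filter_upwards [Ioc_mem_nhdsGT hτ] with t ht
  exact G.interfaceChart_image_subset hτ' (mem_image_of_mem _ ⟨hp.2, ht⟩)

lemma controlled_interfaceChart_image {τ : ℝ} (hτ : τ < G.L₂ - G.L₀) :
    Controlled G.energy (volume.restrict (G.interfaceChart '' (Ioo 0 G.H ×ˢ Ioc 0 τ))) := by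
  refine ⟨2 * τ.toNNReal + 2 * τ.toNNReal ^ 2, fun φ hφ => ?_⟩
  have hΓ : ∫⁻ z in Ioo 0 G.H, ‖φ (G.interfaceChart (z, 0))‖ₑ ^ 2 =
      ∫⁻ x in G.Γ, ‖φ x‖ₑ ^ 2 ∂arc := by
    rw [arc_restrict_Γ, G.measurableEmbedding_interface.lintegral_map]
    simp only [interfaceChart_apply, add_zero]
  refine (setLIntegral_strip_le hφ τ).trans ?_
  push_cast
  grw [← interfaceChart, hΓ, lintegral_mono_set (G.interfaceChart_image_subset hτ), add_mul]
  gcongr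
  exacts [le_rfl, le_add_left le_rfl, le_rfl, le_add_right le_rfl]

lemma controlled_Ω₂ : Controlled G.energy (volume.restrict G.Ω₂) := by
  obtain ⟨τ, hτ, hτ'⟩ := exists_between (sub_pos.2 G.L₀_lt)
  have hsub : G.interfaceChart '' (Ioo 0 G.H ×ˢ Ioo 0 τ) ⊆
      G.interfaceChart '' (Ioo 0 G.H ×ˢ Ioc 0 τ) :=
    image_mono (prod_mono_right Ioo_subset_Ioc_self)
  have hE (φ : Plane → ℝ) : ∫⁻ x in G.Ω₂, ‖gradient φ x‖ₑ ^ 2 ≤ G.energy φ := le_add_right le_rfl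
  refine Controlled.of_isConnected hE G.isOpen_Ω₂ G.isBounded_Ω₂ G.lipschitz G.connected
    (G.interfaceChart.isOpenMap _ (isOpen_Ioo.prod isOpen_Ioo)) ?_
    ((G.controlled_interfaceChart_image hτ').mono_set hsub)
  rw [inter_eq_right.2 (hsub.trans (G.interfaceChart_image_subset hτ'))]
  exact ((nonempty_Ioo.2 G.H_pos).prod (nonempty_Ioo.2 hτ)).image _

end Geometry

/-! ### The Sobolev space `H¹` with boundary traces as a Hilbert space -/

section Gradient

variable {V : Type*} [NormedAddCommGroup V] [InnerProductSpace ℝ V]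

lemma gradient_add [CompleteSpace V] {φ ψ : V → ℝ} (hφ : Differentiable ℝ φ)
    (hψ : Differentiable ℝ ψ) : gradient (φ + ψ) = gradient φ + gradient ψ := by
  ext1 x
  simp only [gradient, Pi.add_apply]
  rw [fderiv_add (hφ x) (hψ x), map_add]

lemma gradient_const_smul [CompleteSpace V] {φ : V → ℝ} (hφ : Differentiable ℝ φ) (c : ℝ) :
    gradient (c • φ) = c • gradient φ := by
  ext1 x
  simp only [gradient, Pi.smul_apply]
  rw [fderiv_const_smul (hφ x), map_smul]

lemma gradient_of_notMem_tsupport [CompleteSpace V] {φ : V → ℝ} {x : V} (hx : x ∉ tsupport φ) :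
    gradient φ x = 0 := by
  rw [gradient, fderiv_of_notMem_tsupport ℝ hx, map_zero]

lemma setIntegral_smul_gradient [FiniteDimensional ℝ V] [MeasurableSpace V] [BorelSpace V]
    {μ : Measure V} [μ.IsAddHaarMeasure] {D : Set V} {ψ φ : V → ℝ} (hψ : ContDiff ℝ 1 ψ)
    (hφ : ContDiff ℝ 1 φ) (hc : HasCompactSupport φ) (hs : tsupport φ ⊆ D) :
    ∫ x in D, ψ x • gradient φ x ∂μ = -∫ x in D, φ x • gradient ψ x ∂μ := by
  rw [setIntegral_eq_integral_of_forall_compl_eq_zero fun x hx => by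
      rw [gradient_of_notMem_tsupport fun h => hx (hs h), smul_zero],
    setIntegral_eq_integral_of_forall_compl_eq_zero fun x hx => by
      rw [image_eq_zero_of_notMem_tsupport fun h => hx (hs h), zero_smul]]
  have hint₁ : Integrable (fun x => ψ x • gradient φ x) μ :=
    (hψ.continuous.smul (continuous_gradient hφ)).integrable_of_hasCompactSupport
      (HasCompactSupport.intro hc fun x hx => gradient_of_notMem_tsupport hx).smul_left
  have hint₂ : Integrable (fun x => φ x • gradient ψ x) μ :=
    (hφ.continuous.smul (continuous_gradient hψ)).integrable_of_hasCompactSupport hc.smul_right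
  refine ext_inner_left ℝ fun v => ?_
  rw [inner_neg_right, ← integral_inner hint₁, ← integral_inner hint₂]
  have hinner₁ (x : V) : inner ℝ v (ψ x • gradient φ x) = ψ x * fderiv ℝ φ x v := by
    rw [inner_smul_right, real_inner_comm, inner_gradient_left]
  have hinner₂ (x : V) : inner ℝ v (φ x • gradient ψ x) = fderiv ℝ ψ x v * φ x := by
    rw [inner_smul_right, real_inner_comm, inner_gradient_left, mul_comm]
  have hv₁ := hint₁.const_inner (𝕜 := ℝ) v
  have hv₂ := hint₂.const_inner (𝕜 := ℝ) v
  simp only [hinner₁, hinner₂] at hv₁ hv₂ ⊢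
  exact integral_mul_fderiv_eq_neg_fderiv_mul_of_integrable hv₂ hv₁
    ((hψ.continuous.mul hφ.continuous).integrable_of_hasCompactSupport hc.mul_left)
    (fun x _ => hψ.differentiable one_ne_zero x) (fun x _ => hφ.differentiable one_ne_zero x)

end Gradient

/-- Bounded open subsets of the plane with Lipschitz boundary; a class, so that Lebesgue measure on
the set and arc length on its boundary are finite by instance search. -/
class IsLipschitzDomain (D : Set Plane) : Prop where
  isOpen : IsOpen D
  isBounded : Bornology.IsBounded D
  hasLipschitzBoundary : HasLipschitzBoundary D

/-- Triples consisting of a function and a vector field on `D` and of a function on `∂D`, all of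
class `L²`; the norm is the Hilbert space norm. -/
abbrev L2Triple (D : Set Plane) : Type :=
  WithLp 2 (Lp ℝ 2 (volume.restrict D) ×
    WithLp 2 (Lp Plane 2 (volume.restrict D) × Lp ℝ 2 (arc.restrict (frontier D))))

namespace L2Triple

variable {D : Set Plane}

/-- The function of a triple. -/
def val : L2Triple D →L[ℝ] Lp ℝ 2 (volume.restrict D) := WithLp.fstL 2 ℝ _ _

/-- The vector field of a triple. -/
def grad : L2Triple D →L[ℝ] Lp Plane 2 (volume.restrict D) :=
  (WithLp.fstL 2 ℝ _ _).comp (WithLp.sndL 2 ℝ _ _)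

/-- The boundary function of a triple. -/
def trace : L2Triple D →L[ℝ] Lp ℝ 2 (arc.restrict (frontier D)) :=
  (WithLp.sndL 2 ℝ _ _).comp (WithLp.sndL 2 ℝ _ _)

lemma norm_sq_eq (x : L2Triple D) : ‖x‖ ^ 2 = ‖val x‖ ^ 2 + ‖grad x‖ ^ 2 + ‖trace x‖ ^ 2 := by
  rw [WithLp.prod_norm_sq_eq_of_L2, WithLp.prod_norm_sq_eq_of_L2, add_assoc]
  rfl

lemma ext {x y : L2Triple D} (hval : val x = val y) (hgrad : grad x = grad y)
    (htrace : trace x = trace y) : x = y :=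
  WithLp.ofLp_injective 2 (Prod.ext hval (WithLp.ofLp_injective 2 (Prod.ext hgrad htrace)))

lemma tendsto_iff {ι : Type*} {l : Filter ι} {x : ι → L2Triple D} {y : L2Triple D} :
    Tendsto x l (𝓝 y) ↔ Tendsto (fun i => val (x i)) l (𝓝 (val y)) ∧
      Tendsto (fun i => grad (x i)) l (𝓝 (grad y)) ∧
      Tendsto (fun i => trace (x i)) l (𝓝 (trace y)) := by
  rw [(WithLp.prodContinuousLinearEquiv 2 ℝ _ _).toHomeomorph.isInducing.tendsto_nhds_iff,
    nhds_prod_eq, tendsto_prod_iff']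
  refine and_congr Iff.rfl ?_
  rw [(WithLp.prodContinuousLinearEquiv 2 ℝ _ _).toHomeomorph.isInducing.tendsto_nhds_iff,
    nhds_prod_eq, tendsto_prod_iff']
  exact Iff.rfl

end L2Triple

namespace H1

variable {D : Set Plane}

/-- The triple of an element of `H¹(D)` and an `L²` function on the boundary, which in applications
is its trace. -/
def toTriple (u : H1 D) {w : Plane → ℝ} (hw : MemLp w 2 (arc.restrict (frontier D))) :
    L2Triple D :=
  WithLp.toLp 2 (u.memLp_val.toLp _, WithLp.toLp 2 (u.memLp_grad.toLp _, hw.toLp w))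

section ToTriple

variable (u : H1 D) {w : Plane → ℝ} (hw : MemLp w 2 (arc.restrict (frontier D)))

@[simp] lemma val_toTriple : L2Triple.val (u.toTriple hw) = u.memLp_val.toLp _ := rfl

@[simp] lemma grad_toTriple : L2Triple.grad (u.toTriple hw) = u.memLp_grad.toLp _ := rfl

@[simp] lemma trace_toTriple : L2Triple.trace (u.toTriple hw) = hw.toLp w := rfl

end ToTriple

lemma tendsto_toTriple_iff {ι : Type*} {l : Filter ι} {u : ι → H1 D} {w : ι → Plane → ℝ}
    {hw : ∀ i, MemLp (w i) 2 (arc.restrict (frontier D))} {v : H1 D} {y : Plane → ℝ}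
    {hy : MemLp y 2 (arc.restrict (frontier D))} :
    Tendsto (fun i => (u i).toTriple (hw i)) l (𝓝 (v.toTriple hy)) ↔
      Tendsto (fun i => eLpNorm (fun p => (u i).val p - v.val p) 2 (volume.restrict D)) l (𝓝 0) ∧
      Tendsto (fun i => eLpNorm (fun p => (u i).grad p - v.grad p) 2 (volume.restrict D)) l
        (𝓝 0) ∧
      Tendsto (fun i => eLpNorm (fun p => w i p - y p) 2 (arc.restrict (frontier D))) l (𝓝 0) := by
  rw [L2Triple.tendsto_iff]
  simp only [val_toTriple, grad_toTriple, trace_toTriple]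
  exact and_congr (Lp.tendsto_Lp_iff_tendsto_eLpNorm'' _ (fun i => (u i).memLp_val) _ v.memLp_val)
    (and_congr
      (Lp.tendsto_Lp_iff_tendsto_eLpNorm'' _ (fun i => (u i).memLp_grad) _ v.memLp_grad)
      (Lp.tendsto_Lp_iff_tendsto_eLpNorm'' _ hw _ hy))

end H1

namespace IsLipschitzDomain

variable (D : Set Plane) [hD : IsLipschitzDomain D]

instance : IsFiniteMeasure (volume.restrict D) := ⟨by simpa using hD.isBounded.measure_lt_top⟩

instance : IsFiniteMeasure (arc.restrict (frontier D)) :=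
  ⟨by simpa using arc_frontier_lt_top hD.isBounded hD.hasLipschitzBoundary⟩

variable {E : Type*} [NormedAddCommGroup E] [SecondCountableTopology E] {f : Plane → E}

lemma memLp_of_continuous (hf : Continuous f) : MemLp f 2 (volume.restrict D) :=
  memLp_restrict_of_continuous hf hD.isOpen.measurableSet hD.isBounded
    hD.isBounded.measure_lt_top.ne 2

lemma memLp_frontier_of_continuous (hf : Continuous f) : MemLp f 2 (arc.restrict (frontier D)) :=
  memLp_restrict_of_continuous hf isClosed_frontier.measurableSet
    (hD.isBounded.closure.subset frontier_subset_closure)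
    (arc_frontier_lt_top hD.isBounded hD.hasLipschitzBoundary).ne 2

end IsLipschitzDomain

section Sobolev

variable (D : Set Plane) [IsLipschitzDomain D] {φ : Plane → ℝ}

open IsLipschitzDomain

/-- A function that is smooth up to the boundary, as an element of `H¹(D)`. -/
def H1.ofSmooth (hφ : ContDiff ℝ ∞ φ) : H1 D where
  val := φ
  grad := gradient φ
  memLp_val := memLp_of_continuous D hφ.continuous
  memLp_grad := memLp_of_continuous D (continuous_gradient (hφ.of_le (by simp)))
  weak _ hψ hc hs := setIntegral_smul_gradient (hφ.of_le (by simp))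
    (hψ.of_le (by simp)) hc hs

/-- The triple of a function that is smooth up to the boundary. -/
def smoothTriple (hφ : ContDiff ℝ ∞ φ) : L2Triple D :=
  (H1.ofSmooth D hφ).toTriple (memLp_frontier_of_continuous D hφ.continuous)

/-- The subspace of the triples of functions that are smooth up to the boundary. -/
def smoothTriples : Submodule ℝ (L2Triple D) where
  carrier := {x | ∃ (φ : Plane → ℝ) (hφ : ContDiff ℝ ∞ φ), smoothTriple D hφ = x}
  zero_mem' := by
    refine ⟨fun _ => 0, contDiff_const, L2Triple.ext ?_ ?_ ?_⟩ <;>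
      simp only [smoothTriple, H1.ofSmooth, H1.val_toTriple, H1.grad_toTriple, H1.trace_toTriple,
        map_zero, gradient_fun_const'] <;> rfl
  add_mem' := by
    rintro _ _ ⟨φ, hφ, rfl⟩ ⟨ψ, hψ, rfl⟩
    refine ⟨φ + ψ, hφ.add hψ, L2Triple.ext ?_ ?_ ?_⟩ <;>
      simp only [smoothTriple, H1.ofSmooth, H1.val_toTriple, H1.grad_toTriple, H1.trace_toTriple,
        map_add, gradient_add (hφ.differentiable (by simp)) (hψ.differentiable (by simp))] <;> rfl
  smul_mem' := by
    rintro c _ ⟨φ, hφ, rfl⟩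
    refine ⟨c • φ, hφ.const_smul c, L2Triple.ext ?_ ?_ ?_⟩ <;>
      simp only [smoothTriple, H1.ofSmooth, H1.val_toTriple, H1.grad_toTriple, H1.trace_toTriple,
        map_smul, gradient_const_smul (hφ.differentiable (by simp))] <;> rfl

/-- The triples `(u, ∇u, trace of u)` with `u ∈ H¹(D)`, as the closure of the triples of smooth
functions; see `mem_sobolev_iff`. -/
def sobolev : Submodule ℝ (L2Triple D) := (smoothTriples D).topologicalClosure

variable {D}

lemma isClosed_sobolev : IsClosed (sobolev D : Set (L2Triple D)) :=
  (smoothTriples D).isClosed_topologicalClosure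

lemma sobolev_induction {P : L2Triple D → Prop} (hP : IsClosed {x | P x})
    (h : ∀ (φ : Plane → ℝ) (hφ : ContDiff ℝ ∞ φ), P (smoothTriple D hφ)) {x : L2Triple D}
    (hx : x ∈ sobolev D) : P x :=
  closure_minimal (by rintro _ ⟨φ, hφ, rfl⟩; exact h φ hφ) hP hx

lemma H1.hasTrace_iff_toTriple_mem_sobolev {u : H1 D} {w : Plane → ℝ}
    (hw : MemLp w 2 (arc.restrict (frontier D))) :
    u.HasTrace w ↔ u.toTriple hw ∈ sobolev D := by
  have hlim (φ : ℕ → Plane → ℝ) (hφ : ∀ n, ContDiff ℝ ∞ (φ n)) :=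
    H1.tendsto_toTriple_iff (l := atTop) (u := fun n => H1.ofSmooth D (hφ n)) (w := φ)
      (hw := fun n => memLp_frontier_of_continuous D (hφ n).continuous) (v := u) (hy := hw)
  constructor
  · rintro ⟨-, φ, hφ, h⟩
    exact mem_closure_iff_seq_limit.2
      ⟨fun n => smoothTriple D (hφ n), fun n => ⟨φ n, hφ n, rfl⟩, (hlim φ hφ).2 h⟩
  · intro h
    obtain ⟨y, hy, hyu⟩ := mem_closure_iff_seq_limit.1 h
    choose φ hφ hyφ using hy
    obtain rfl := funext hyφ
    exact ⟨hw, φ, hφ, (hlim φ hφ).1 hyu⟩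

lemma H1.HasTrace.toTriple_mem {u : H1 D} {w : Plane → ℝ} (h : u.HasTrace w) :
    u.toTriple h.1 ∈ sobolev D :=
  (H1.hasTrace_iff_toTriple_mem_sobolev h.1).1 h

lemma H1.hasTrace_ofSmooth (hφ : ContDiff ℝ ∞ φ) : (H1.ofSmooth D hφ).HasTrace φ :=
  (H1.hasTrace_iff_toTriple_mem_sobolev _).2 (subset_closure ⟨φ, hφ, rfl⟩)

lemma setIntegral_smul_gradient_of_mem_sobolev {x : L2Triple D} (hx : x ∈ sobolev D)
    (hφ : ContDiff ℝ ∞ φ) (hc : HasCompactSupport φ) (hs : tsupport φ ⊆ D) :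
    ∫ p in D, L2Triple.val x p • gradient φ p = -∫ p in D, φ p • L2Triple.grad x p := by
  let pairing := (ContinuousLinearMap.lsmul ℝ ℝ : ℝ →L[ℝ] Plane →L[ℝ] Plane).lpPairing
    (volume.restrict D) 2 2
  let ofφ := H1.ofSmooth D hφ
  have hval (x : L2Triple D) : ∫ p in D, L2Triple.val x p • gradient φ p =
      pairing (L2Triple.val x) (ofφ.memLp_grad.toLp _) := by
    rw [ContinuousLinearMap.lpPairing_eq_integral]
    refine integral_congr_ae ?_
    filter_upwards [ofφ.memLp_grad.coeFn_toLp] with p hp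
    rw [hp]
    rfl
  have hgrad (x : L2Triple D) : ∫ p in D, φ p • L2Triple.grad x p =
      pairing (ofφ.memLp_val.toLp _) (L2Triple.grad x) := by
    rw [ContinuousLinearMap.lpPairing_eq_integral]
    refine integral_congr_ae ?_
    filter_upwards [ofφ.memLp_val.coeFn_toLp] with p hp
    rw [hp]
    rfl
  refine sobolev_induction (P := fun x => ∫ p in D, L2Triple.val x p • gradient φ p =
    -∫ p in D, φ p • L2Triple.grad x p) ?_ (fun ψ hψ => ?_) hx
  · simp only [hval, hgrad]
    exact isClosed_eq (by fun_prop) (by fun_prop)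
  · let ofψ := H1.ofSmooth D hψ
    calc ∫ p in D, L2Triple.val (smoothTriple D hψ) p • gradient φ p
        = ∫ p in D, ψ p • gradient φ p := by
          refine integral_congr_ae ?_
          filter_upwards [ofψ.memLp_val.coeFn_toLp] with p hp using congrArg (· • gradient φ p) hp
      _ = -∫ p in D, φ p • gradient ψ p := ofψ.weak φ hφ hc hs
      _ = -∫ p in D, φ p • L2Triple.grad (smoothTriple D hψ) p := by
          congr 1
          refine integral_congr_ae ?_
          filter_upwards [ofψ.memLp_grad.coeFn_toLp] with p hp using congrArg (φ p • ·) hp.symm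

lemma mem_sobolev_iff {x : L2Triple D} :
    x ∈ sobolev D ↔ ∃ (u : H1 D) (w : Plane → ℝ) (h : u.HasTrace w), u.toTriple h.1 = x := by
  refine ⟨fun hx => ?_, fun ⟨u, w, h, hux⟩ => hux ▸ h.toTriple_mem⟩
  let u : H1 D := ⟨L2Triple.val x, L2Triple.grad x, Lp.memLp _, Lp.memLp _,
    fun φ hφ hc hs => setIntegral_smul_gradient_of_mem_sobolev hx hφ hc hs⟩
  have hux : u.toTriple (Lp.memLp (L2Triple.trace x)) = x := by
    refine L2Triple.ext ?_ ?_ ?_ <;> simp [u]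
  exact ⟨u, L2Triple.trace x, (H1.hasTrace_iff_toTriple_mem_sobolev _).2 (by rwa [hux]), hux⟩

end Sobolev

/-! ### The weak formulation in `Ω₂` -/

section L2

variable {α E : Type*} [MeasurableSpace α] {μ : Measure α} [NormedAddCommGroup E]

lemma enorm_toLp_two_sq {f : α → E} (hf : MemLp f 2 μ) :
    ‖hf.toLp f‖ₑ ^ 2 = ∫⁻ a, ‖f a‖ₑ ^ 2 ∂μ := by
  simpa [Lp.enorm_toLp] using eLpNorm_nnreal_pow_eq_lintegral (μ := μ) (f := f) two_ne_zero

lemma inner_toLp [InnerProductSpace ℝ E] {f g : α → E} (hf : MemLp f 2 μ) (hg : MemLp g 2 μ) :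
    inner ℝ (hf.toLp f) (hg.toLp g) = ∫ a, inner ℝ (f a) (g a) ∂μ := by
  rw [L2.inner_def]
  refine integral_congr_ae ?_
  filter_upwards [hf.coeFn_toLp, hg.coeFn_toLp] with a ha hb
  rw [ha, hb]

lemma norm_sq_le_of_enorm_sq_le {E₁ E₂ E₃ : Type*} [SeminormedAddGroup E₁] [SeminormedAddGroup E₂]
    [SeminormedAddGroup E₃] {x : E₁} {y : E₂} {z : E₃} {c : ℝ≥0}
    (h : ‖x‖ₑ ^ 2 ≤ c * (‖y‖ₑ ^ 2 + ‖z‖ₑ ^ 2)) : ‖x‖ ^ 2 ≤ c * (‖y‖ ^ 2 + ‖z‖ ^ 2) := by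
  simp only [enorm_eq_nnnorm] at h
  have hnn : ‖x‖₊ ^ 2 ≤ c * (‖y‖₊ ^ 2 + ‖z‖₊ ^ 2) := by exact_mod_cast h
  exact_mod_cast hnn

end L2

section Trace

variable {D : Set Plane}

/-- The restriction of the boundary function of a triple to a part of the boundary. -/
def L2Triple.traceOn (s : Set Plane) :
    L2Triple D →L[ℝ] Lp ℝ 2 ((arc.restrict (frontier D)).restrict s) :=
  (LpToLpRestrictCLM Plane ℝ ℝ _ 2 s).comp L2Triple.trace

@[simp] lemma H1.traceOn_toTriple (s : Set Plane) (u : H1 D) {w : Plane → ℝ}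
    (hw : MemLp w 2 (arc.restrict (frontier D))) :
    L2Triple.traceOn s (u.toTriple hw) = (hw.restrict s).toLp w := by
  refine Lp.ext ((LpToLpRestrictCLM_coeFn ℝ s (hw.toLp w)).trans ?_)
  exact EventuallyEq.trans (ae_restrict_of_ae hw.coeFn_toLp) (hw.restrict s).coeFn_toLp.symm

lemma inner_traceOn_toTriple (s : Set Plane) (u v : H1 D) {w y : Plane → ℝ}
    (hw : MemLp w 2 (arc.restrict (frontier D))) (hy : MemLp y 2 (arc.restrict (frontier D))) :
    inner ℝ (L2Triple.traceOn s (u.toTriple hw)) (L2Triple.traceOn s (v.toTriple hy)) =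
      ∫ p, w p * y p ∂(arc.restrict (frontier D)).restrict s := by
  rw [H1.traceOn_toTriple, H1.traceOn_toTriple, inner_toLp]
  exact integral_congr_ae (ae_of_all _ fun p => mul_comm _ _)

variable [hD : IsLipschitzDomain D]

variable (D) in
lemma exists_norm_trace_sq_le : ∃ c : ℝ≥0, ∀ x ∈ sobolev D,
    ‖L2Triple.trace x‖ ^ 2 ≤ c * (‖L2Triple.val x‖ ^ 2 + ‖L2Triple.grad x‖ ^ 2) := by
  obtain ⟨c, hc⟩ := controlled_frontier hD.isBounded hD.hasLipschitzBoundary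
  refine ⟨c, fun x hx => sobolev_induction (P := fun x => ‖L2Triple.trace x‖ ^ 2 ≤
    c * (‖L2Triple.val x‖ ^ 2 + ‖L2Triple.grad x‖ ^ 2)) ?_ (fun φ hφ => ?_) hx⟩
  · exact isClosed_le (by fun_prop) (by fun_prop)
  · refine norm_sq_le_of_enorm_sq_le ?_
    simp only [smoothTriple, H1.val_toTriple, H1.grad_toTriple, H1.trace_toTriple,
      enorm_toLp_two_sq]
    exact hc φ (hφ.of_le (by simp))

lemma H1.HasTrace.ae_eq {u : H1 D} {w w' : Plane → ℝ} (h : u.HasTrace w) (h' : u.HasTrace w') :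
    w =ᵐ[arc.restrict (frontier D)] w' := by
  obtain ⟨c, hc⟩ := exists_norm_trace_sq_le D
  have hsub := hc _ ((sobolev D).sub_mem h.toTriple_mem h'.toTriple_mem)
  simp only [map_sub, H1.val_toTriple, H1.grad_toTriple, H1.trace_toTriple, sub_self, norm_zero,
    ne_eq, OfNat.ofNat_ne_zero, not_false_eq_true, zero_pow, add_zero, mul_zero] at hsub
  refine (MemLp.toLp_eq_toLp_iff h.1 h'.1).1 (sub_eq_zero.1 (norm_eq_zero.1 ?_))
  exact pow_eq_zero_iff two_ne_zero |>.1 (hsub.antisymm (sq_nonneg _))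

end Trace

lemma lax_milgram_of_isClosed {E : Type*} [NormedAddCommGroup E] [InnerProductSpace ℝ E]
    [CompleteSpace E] {K : Submodule ℝ E} (hK : IsClosed (K : Set E)) {B : E →L[ℝ] E →L[ℝ] ℝ}
    {c : ℝ} (hc : 0 < c) (hB : ∀ x ∈ K, c * ‖x‖ ^ 2 ≤ B x x) (f : E →L[ℝ] ℝ) :
    ∃ x ∈ K, ∀ y ∈ K, B x y = f y := by
  have : CompleteSpace K := hK.completeSpace_coe
  have hcoercive : IsCoercive (B.bilinearComp K.subtypeL K.subtypeL) := by
    refine ⟨c, hc, fun x => ?_⟩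
    have h := hB x x.2
    rwa [pow_two, ← mul_assoc] at h
  let z : K := (InnerProductSpace.toDual ℝ K).symm (f.comp K.subtypeL)
  let x : K := hcoercive.continuousLinearEquivOfBilin.symm z
  refine ⟨x, x.2, fun y hy => ?_⟩
  have h := hcoercive.continuousLinearEquivOfBilin_apply x ⟨y, hy⟩
  rw [ContinuousLinearEquiv.apply_symm_apply, InnerProductSpace.toDual_symm_apply] at h
  exact h.symm

namespace Geometry

open L2Triple

variable (G : Geometry)

instance : IsLipschitzDomain G.Ω₂ := ⟨G.isOpen_Ω₂, G.isBounded_Ω₂, G.lipschitz⟩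

lemma arc_restrict_frontier_restrict_Γ :
    (arc.restrict (frontier G.Ω₂)).restrict G.Γ = arc.restrict G.Γ := by
  rw [Measure.restrict_restrict G.measurableSet_Γ, inter_eq_left.2 G.Γ_subset_frontier]

lemma exists_norm_val_sq_le : ∃ c : ℝ≥0, ∀ x ∈ sobolev G.Ω₂,
    ‖val x‖ ^ 2 ≤ c * (‖grad x‖ ^ 2 + ‖traceOn G.Γ x‖ ^ 2) := by
  obtain ⟨c, hc⟩ := G.controlled_Ω₂
  refine ⟨c, fun x hx => sobolev_induction (P := fun x => ‖val x‖ ^ 2 ≤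
    c * (‖grad x‖ ^ 2 + ‖traceOn G.Γ x‖ ^ 2)) ?_ (fun φ hφ => ?_) hx⟩
  · exact isClosed_le (by fun_prop) (by fun_prop)
  · refine norm_sq_le_of_enorm_sq_le ?_
    simp only [smoothTriple, H1.val_toTriple, H1.grad_toTriple, H1.traceOn_toTriple,
      enorm_toLp_two_sq, arc_restrict_frontier_restrict_Γ]
    exact hc φ (hφ.of_le (by simp))

lemma exists_norm_sq_le : ∃ C > 0, ∀ x ∈ sobolev G.Ω₂,
    ‖x‖ ^ 2 ≤ C * (‖grad x‖ ^ 2 + ‖traceOn G.Γ x‖ ^ 2) := by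
  obtain ⟨a, ha⟩ := exists_norm_trace_sq_le G.Ω₂
  obtain ⟨c, hc⟩ := G.exists_norm_val_sq_le
  refine ⟨(1 + a) * (c + 1), by positivity, fun x hx => ?_⟩
  calc ‖x‖ ^ 2 = ‖val x‖ ^ 2 + ‖grad x‖ ^ 2 + ‖trace x‖ ^ 2 := norm_sq_eq x
    _ ≤ (1 + a) * (‖val x‖ ^ 2 + ‖grad x‖ ^ 2) := by linarith [ha x hx]
    _ ≤ (1 + a) * ((c + 1) * (‖grad x‖ ^ 2 + ‖traceOn G.Γ x‖ ^ 2)) := by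
      gcongr
      linarith [hc x hx, sq_nonneg ‖traceOn G.Γ x‖]
    _ = _ := by ring

/-- The bilinear form of the weak formulation in `Ω₂`. -/
def form (κ lam : ℝ) : L2Triple G.Ω₂ →L[ℝ] L2Triple G.Ω₂ →L[ℝ] ℝ :=
  let innerComp {E : Type} [NormedAddCommGroup E] [InnerProductSpace ℝ E]
    (A : L2Triple G.Ω₂ →L[ℝ] E) : L2Triple G.Ω₂ →L[ℝ] L2Triple G.Ω₂ →L[ℝ] ℝ :=
    (innerSL ℝ).bilinearComp A A
  innerComp grad + κ • innerComp (traceOn G.ΓB) + lam • innerComp (traceOn G.Γ)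

/-- The functional `v ↦ ∫ F v` of the weak formulation in `Ω₂`. -/
def source {F : Plane → ℝ} (hF : MemLp F 2 (volume.restrict G.Ω₂)) : L2Triple G.Ω₂ →L[ℝ] ℝ :=
  (innerSL ℝ (hF.toLp F)).comp val

/-- The average over the interface of the boundary function of a triple. -/
def interfaceAvg : L2Triple G.Ω₂ →L[ℝ] ℝ :=
  (1 / G.H) • (innerSL ℝ ((memLp_const (1 : ℝ)).toLp _)).comp (traceOn G.Γ)

/-- The triples of functions in `H¹(Ω₂)` that vanish on `ΓR`. -/
def homogeneous : Submodule ℝ (L2Triple G.Ω₂) := sobolev G.Ω₂ ⊓ (traceOn G.ΓR).ker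

lemma isClosed_homogeneous : IsClosed (G.homogeneous : Set (L2Triple G.Ω₂)) :=
  isClosed_sobolev.inter (traceOn G.ΓR).isClosed_ker

variable {G} {κ lam : ℝ}

lemma form_self (x : L2Triple G.Ω₂) :
    G.form κ lam x x = ‖grad x‖ ^ 2 + κ * ‖traceOn G.ΓB x‖ ^ 2 + lam * ‖traceOn G.Γ x‖ ^ 2 := by
  simp only [← real_inner_self_eq_norm_sq]
  rfl

lemma exists_mul_norm_sq_le_form (hκ : 0 ≤ κ) (hlam : 0 < lam) :
    ∃ c > 0, ∀ x ∈ sobolev G.Ω₂, c * ‖x‖ ^ 2 ≤ G.form κ lam x x := by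
  obtain ⟨C, hC, h⟩ := G.exists_norm_sq_le
  refine ⟨min 1 lam / C, by positivity, fun x hx => ?_⟩
  calc min 1 lam / C * ‖x‖ ^ 2
      ≤ min 1 lam / C * (C * (‖grad x‖ ^ 2 + ‖traceOn G.Γ x‖ ^ 2)) := by
        gcongr
        exact h x hx
    _ = min 1 lam * ‖grad x‖ ^ 2 + min 1 lam * ‖traceOn G.Γ x‖ ^ 2 := by field_simp
    _ ≤ 1 * ‖grad x‖ ^ 2 + lam * ‖traceOn G.Γ x‖ ^ 2 := by
        gcongr
        exacts [min_le_left _ _, min_le_right _ _]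
    _ ≤ G.form κ lam x x := by
        rw [form_self]
        linarith [mul_nonneg hκ (sq_nonneg ‖traceOn G.ΓB x‖)]

section ToTriple

variable {u v : H1 G.Ω₂} {w y : Plane → ℝ} (hw : MemLp w 2 (arc.restrict (frontier G.Ω₂)))
  (hy : MemLp y 2 (arc.restrict (frontier G.Ω₂)))

lemma form_toTriple :
    G.form κ lam (u.toTriple hw) (v.toTriple hy) =
      (∫ p in G.Ω₂, inner ℝ (u.grad p) (v.grad p))
        + κ * (∫ p in G.ΓB ∩ frontier G.Ω₂, w p * y p ∂arc)
        + lam * (∫ p in G.Γ, w p * y p ∂arc) := by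
  rw [← inner_toLp u.memLp_grad v.memLp_grad, ← Measure.restrict_restrict G.measurable_ΓB,
    ← arc_restrict_frontier_restrict_Γ, ← inner_traceOn_toTriple _ u v hw hy,
    ← inner_traceOn_toTriple _ u v hw hy]
  rfl

lemma source_toTriple {F : Plane → ℝ} (hF : MemLp F 2 (volume.restrict G.Ω₂)) :
    G.source hF (v.toTriple hy) = ∫ p in G.Ω₂, F p * v.val p :=
  (inner_toLp hF v.memLp_val).trans (integral_congr_ae (ae_of_all _ fun _ => mul_comm _ _))

lemma interfaceAvg_toTriple : G.interfaceAvg (v.toTriple hy) = G.avg y G.L₀ := by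
  rw [avg_eq_integral_Γ, ← arc_restrict_frontier_restrict_Γ]
  simp only [interfaceAvg, smul_apply, ContinuousLinearMap.comp_apply, innerSL_apply_apply,
    H1.traceOn_toTriple, inner_toLp, smul_eq_mul, RCLike.inner_apply, map_one, mul_one]

lemma traceOn_toTriple_eq_iff {s : Set Plane} (hs : MeasurableSet s) :
    traceOn s (u.toTriple hw) = traceOn s (v.toTriple hy) ↔
      w =ᵐ[arc.restrict (s ∩ frontier G.Ω₂)] y := by
  rw [H1.traceOn_toTriple, H1.traceOn_toTriple, MemLp.toLp_eq_toLp_iff,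
    Measure.restrict_restrict hs]

end ToTriple

lemma mul_sq_interfaceAvg_le (x : L2Triple G.Ω₂) :
    G.H * G.interfaceAvg x ^ 2 ≤ ‖traceOn G.Γ x‖ ^ 2 := by
  let one : Lp ℝ 2 ((arc.restrict (frontier G.Ω₂)).restrict G.Γ) := (memLp_const (1 : ℝ)).toLp _
  have hH := G.H_pos
  have hone : ‖one‖ ^ 2 = G.H := by
    rw [← real_inner_self_eq_norm_sq, inner_toLp, arc_restrict_frontier_restrict_Γ]
    simp [Measure.real, arc_Γ, hH.le]
  have hcs : |inner ℝ one (traceOn G.Γ x)| ^ 2 ≤ (‖one‖ * ‖traceOn G.Γ x‖) ^ 2 := by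
    gcongr
    exact abs_real_inner_le_norm _ _
  rw [sq_abs, mul_pow, hone] at hcs
  calc G.H * G.interfaceAvg x ^ 2 = 1 / G.H * inner ℝ one (traceOn G.Γ x) ^ 2 := by
        change G.H * (1 / G.H * inner ℝ one (traceOn G.Γ x)) ^ 2 = _
        field_simp
    _ ≤ 1 / G.H * (G.H * ‖traceOn G.Γ x‖ ^ 2) := by gcongr
    _ = ‖traceOn G.Γ x‖ ^ 2 := by field_simp

end Geometry

section IsSolution2D

open SchwarzCoupling.Geometry L2Triple

variable {G : Geometry} {κ lam : ℝ} {F γ₂ : Plane → ℝ}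

lemma H1.HasTrace.toTriple_mem_homogeneous_iff {v : H1 G.Ω₂} {y : Plane → ℝ} (hy : v.HasTrace y) :
    v.toTriple hy.1 ∈ G.homogeneous ↔
      ∀ᵐ p ∂(arc.restrict (G.ΓR ∩ frontier G.Ω₂)), y p = 0 := by
  rw [homogeneous, Submodule.mem_inf, and_iff_right hy.toTriple_mem,
    ← Measure.restrict_restrict G.measurable_ΓR]
  change traceOn G.ΓR (v.toTriple hy.1) = 0 ↔ _
  rw [H1.traceOn_toTriple, Lp.eq_zero_iff_ae_eq_zero]
  have hcoe := (hy.1.restrict G.ΓR).coeFn_toLp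
  exact ⟨hcoe.symm.trans, hcoe.trans⟩

lemma H1.HasTrace.isSolution2D_iff {u : H1 G.Ω₂} {w : Plane → ℝ} (hw : u.HasTrace w)
    (hF : MemLp F 2 (volume.restrict G.Ω₂)) {c : ℝ} :
    IsSolution2D G κ lam F γ₂ c u ↔ w =ᵐ[arc.restrict (G.ΓR ∩ frontier G.Ω₂)] γ₂ ∧
      ∀ z ∈ G.homogeneous, G.form κ lam (u.toTriple hw.1) z =
        G.source hF z + c * (G.H * G.interfaceAvg z) := by
  have hΓ (y : Plane → ℝ) : ∫ p in G.Γ, c * y p ∂arc = c * (G.H * G.avg y G.L₀) := by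
    have hH := G.H_pos.ne'
    rw [integral_const_mul, avg_eq_integral_Γ]
    field_simp
  constructor
  · rintro ⟨w', hw', hR, hweak⟩
    have hww' := hw.ae_eq hw'
    have htriple : u.toTriple hw.1 = u.toTriple hw'.1 :=
      L2Triple.ext rfl rfl ((MemLp.toLp_eq_toLp_iff hw.1 hw'.1).2 hww')
    refine ⟨EventuallyEq.trans
      (ae_restrict_of_ae_restrict_of_subset inter_subset_right hww') hR, fun z hz => ?_⟩
    obtain ⟨v, y, hy, rfl⟩ := mem_sobolev_iff.1 hz.1
    rw [htriple, form_toTriple, source_toTriple, interfaceAvg_toTriple, ← hΓ,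
      hweak v y hy (hy.toTriple_mem_homogeneous_iff.1 hz)]
  · rintro ⟨hR, hweak⟩
    refine ⟨w, hw, hR, fun v y hy hyR => ?_⟩
    have h := hweak _ (hy.toTriple_mem_homogeneous_iff.2 hyR)
    rwa [form_toTriple, source_toTriple, interfaceAvg_toTriple, ← hΓ] at h

lemma exists_isSolution2D (hκ : 0 ≤ κ) (hlam : 0 < lam)
    (hF : MemLp F 2 (volume.restrict G.Ω₂)) (hγ₂ : IsDirichletDatum G γ₂) (c : ℝ) :
    ∃ u, IsSolution2D G κ lam F γ₂ c u := by
  obtain ⟨v, y, hy, hyR⟩ := hγ₂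
  obtain ⟨a, ha, hform⟩ := exists_mul_norm_sq_le_form (G := G) hκ hlam
  obtain ⟨z, hz, hzform⟩ := lax_milgram_of_isClosed G.isClosed_homogeneous ha
    (fun x hx => hform x hx.1)
    (G.source hF + (c * G.H) • G.interfaceAvg - G.form κ lam (v.toTriple hy.1))
  obtain ⟨u, w, hw, hu⟩ := mem_sobolev_iff.1 ((sobolev G.Ω₂).add_mem hy.toTriple_mem hz.1)
  refine ⟨u, (hw.isSolution2D_iff hF).2 ⟨EventuallyEq.trans ?_ hyR, fun x hx => ?_⟩⟩
  · have hzR : traceOn G.ΓR z = 0 := hz.2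
    rw [← traceOn_toTriple_eq_iff (u := u) (v := v) hw.1 hy.1 G.measurable_ΓR, hu, map_add, hzR,
      add_zero]
  · rw [hu, map_add, add_apply, hzform x hx]
    simp only [sub_apply, add_apply, smul_apply, smul_eq_mul]
    ring

section Difference

variable {c c' : ℝ} {u u' : H1 G.Ω₂} {w w' : Plane → ℝ}

lemma IsSolution2D.sub_mem_homogeneous (hu : IsSolution2D G κ lam F γ₂ c u)
    (hu' : IsSolution2D G κ lam F γ₂ c' u') (hw : u.HasTrace w) (hw' : u'.HasTrace w')
    (hF : MemLp F 2 (volume.restrict G.Ω₂)) :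
    u.toTriple hw.1 - u'.toTriple hw'.1 ∈ G.homogeneous := by
  refine ⟨(sobolev G.Ω₂).sub_mem hw.toTriple_mem hw'.toTriple_mem, ?_⟩
  change traceOn G.ΓR _ = 0
  rw [map_sub, sub_eq_zero, traceOn_toTriple_eq_iff _ _ G.measurable_ΓR]
  exact ((hw.isSolution2D_iff hF).1 hu).1.trans ((hw'.isSolution2D_iff hF).1 hu').1.symm

lemma IsSolution2D.form_sub_self (hu : IsSolution2D G κ lam F γ₂ c u)
    (hu' : IsSolution2D G κ lam F γ₂ c' u') (hw : u.HasTrace w) (hw' : u'.HasTrace w')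
    (hF : MemLp F 2 (volume.restrict G.Ω₂)) :
    G.form κ lam (u.toTriple hw.1 - u'.toTriple hw'.1) (u.toTriple hw.1 - u'.toTriple hw'.1) =
      (c - c') * (G.H * G.interfaceAvg (u.toTriple hw.1 - u'.toTriple hw'.1)) := by
  have hz := hu.sub_mem_homogeneous hu' hw hw' hF
  set z := u.toTriple hw.1 - u'.toTriple hw'.1
  calc G.form κ lam z z
      = G.form κ lam (u.toTriple hw.1) z - G.form κ lam (u'.toTriple hw'.1) z :=
        (G.form κ lam).map_sub₂ _ _ z
    _ = (c - c') * (G.H * G.interfaceAvg z) := by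
        rw [((hw.isSolution2D_iff hF).1 hu).2 z hz, ((hw'.isSolution2D_iff hF).1 hu').2 z hz]
        ring

/-- The energy identity bounds `lam * m ^ 2` by `m * (c - c')`, where `m` is the difference of the
averages; this is the claim, squared. -/
lemma IsSolution2D.abs_reflection_sub_le (hu : IsSolution2D G κ lam F γ₂ c u)
    (hu' : IsSolution2D G κ lam F γ₂ c' u') (hw : u.HasTrace w) (hw' : u'.HasTrace w')
    (hF : MemLp F 2 (volume.restrict G.Ω₂)) (hκ : 0 ≤ κ) (hlam : 0 < lam) :
    |(2 * lam * G.avg w G.L₀ - c) - (2 * lam * G.avg w' G.L₀ - c')| ≤ |c - c'| := by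
  have henergy := hu.form_sub_self hu' hw hw' hF
  have hcs := mul_sq_interfaceAvg_le (u.toTriple hw.1 - u'.toTriple hw'.1)
  rw [form_self, map_sub G.interfaceAvg, interfaceAvg_toTriple, interfaceAvg_toTriple] at henergy
  rw [map_sub G.interfaceAvg, interfaceAvg_toTriple, interfaceAvg_toTriple] at hcs
  set m := G.avg w G.L₀ - G.avg w' G.L₀ with hm
  set z := u.toTriple hw.1 - u'.toTriple hw'.1
  have hlower : lam * m ^ 2 ≤ (c - c') * m := by
    refine le_of_mul_le_mul_left ?_ G.H_pos
    linarith [mul_le_mul_of_nonneg_left hcs hlam.le, mul_nonneg hκ (sq_nonneg ‖traceOn G.ΓB z‖),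
      sq_nonneg ‖grad z‖]
  calc |(2 * lam * G.avg w G.L₀ - c) - (2 * lam * G.avg w' G.L₀ - c')|
      = |2 * lam * m - (c - c')| := by
        rw [hm]
        ring_nf
    _ ≤ |c - c'| := sq_le_sq.1 (by linarith [mul_le_mul_of_nonneg_left hlower hlam.le])

end Difference

lemma exists_norm_toTriple_sub_le (hF : MemLp F 2 (volume.restrict G.Ω₂)) (hκ : 0 ≤ κ)
    (hlam : 0 < lam) :
    ∃ C : ℝ, ∀ {c c' : ℝ} {u u' : H1 G.Ω₂} {w w' : Plane → ℝ} (hw : u.HasTrace w)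
      (hw' : u'.HasTrace w'), IsSolution2D G κ lam F γ₂ c u → IsSolution2D G κ lam F γ₂ c' u' →
        ‖u.toTriple hw.1 - u'.toTriple hw'.1‖ ≤ C * |c - c'| := by
  obtain ⟨a, ha, hform⟩ := exists_mul_norm_sq_le_form (G := G) hκ hlam
  refine ⟨G.H * ‖G.interfaceAvg‖ / a, fun {c c' u u' w w'} hw hw' hu hu' => ?_⟩
  have hH := G.H_pos
  have hcoercive := hform _ (hu.sub_mem_homogeneous hu' hw hw' hF).1
  rw [hu.form_sub_self hu' hw hw' hF] at hcoercive
  set z := u.toTriple hw.1 - u'.toTriple hw'.1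
  have hupper : (c - c') * (G.H * G.interfaceAvg z) ≤ |c - c'| * (G.H * (‖G.interfaceAvg‖ * ‖z‖)) :=
    calc (c - c') * (G.H * G.interfaceAvg z) ≤ |c - c'| * (G.H * |G.interfaceAvg z|) := by
          rw [← abs_of_pos hH, ← abs_mul, ← abs_mul, abs_of_pos hH]
          exact le_abs_self _
      _ ≤ _ := by
          gcongr
          exact G.interfaceAvg.le_opNorm z
  rcases (norm_nonneg z).eq_or_lt with hz | hz
  · rw [← hz]
    positivity
  · rw [div_mul_eq_mul_div, le_div_iff₀ ha]
    refine le_of_mul_le_mul_right ?_ hz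
    linarith

lemma convergesH1_of_tendsto (hκ : 0 ≤ κ) (hlam : 0 < lam)
    (hF : MemLp F 2 (volume.restrict G.Ω₂)) {c : ℕ → ℝ} {u : ℕ → H1 G.Ω₂} {c' : ℝ} {u' : H1 G.Ω₂}
    (hu : ∀ᶠ k in atTop, IsSolution2D G κ lam F γ₂ (c k) (u k))
    (hu' : IsSolution2D G κ lam F γ₂ c' u') (hc : Tendsto c atTop (𝓝 c')) : ConvergesH1 u u' := by
  obtain ⟨N, hN⟩ := eventually_atTop.1 hu
  obtain ⟨C, hC⟩ := exists_norm_toTriple_sub_le (G := G) (γ₂ := γ₂) hF hκ hlam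
  choose w hw using fun k => hN (k + N) (Nat.le_add_left N k)
  have ⟨w', hw', _⟩ := hu'
  have hbound : Tendsto (fun k => C * |c (k + N) - c'|) atTop (𝓝 0) := by
    simpa using (((tendsto_add_atTop_iff_nat N).2 hc).sub_const c').abs.const_mul C
  have htriple : Tendsto (fun k => (u (k + N)).toTriple (hw k).1.1) atTop
      (𝓝 (u'.toTriple hw'.1)) := by
    refine tendsto_iff_norm_sub_tendsto_zero.2 (squeeze_zero (fun _ => norm_nonneg _)
      (fun k => hC (hw k).1 hw' (hN _ (Nat.le_add_left N k)) hu') hbound)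
  obtain ⟨hval, hgrad, -⟩ := H1.tendsto_toTriple_iff.1 htriple
  exact ⟨(tendsto_add_atTop_iff_nat N).1 hval, (tendsto_add_atTop_iff_nat N).1 hgrad⟩

end IsSolution2D

/-! ### Normal derivatives on the interface -/

lemma integral_mul_sub_of_memLp_two {α : Type*} [MeasurableSpace α] {μ : Measure α}
    {φ f g : α → ℝ} (hφ : MemLp φ 2 μ) (hf : MemLp f 2 μ) (hg : MemLp g 2 μ) :
    ∫ a, φ a * (f a - g a) ∂μ = (∫ a, f a * φ a ∂μ) - ∫ a, g a * φ a ∂μ := by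
  have hfφ : Integrable (fun a => f a * φ a) μ := hf.integrable_mul hφ
  have hgφ : Integrable (fun a => g a * φ a) μ := hg.integrable_mul hφ
  rw [← integral_sub hfφ hgφ]
  congr! 2 with a
  ring

section NormalDeriv

variable {D Γ : Set Plane}

lemma H1.HasNormalDeriv.exists_integral_mul_sub_eq [IsLipschitzDomain D] {u : H1 D}
    {q q' : Plane → ℝ} (hΓ : MeasurableSet Γ) (hΓD : Γ ⊆ frontier D) (h : u.HasNormalDeriv Γ q)
    (h' : u.HasNormalDeriv Γ q') :
    ∃ l : Plane → ℝ, IntegrableOn l D ∧ ∀ φ : Plane → ℝ, ContDiff ℝ ∞ φ →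
      (∀ p ∈ frontier D \ Γ, φ p = 0) →
        ∫ p in D, φ p * l p = ∫ p in Γ, φ p * (q p - q' p) ∂arc := by
  obtain ⟨hq, l, hl, hgreen⟩ := h
  obtain ⟨hq', l', hl', hgreen'⟩ := h'
  refine ⟨fun p => l p - l' p, (hl.sub hl').integrable one_le_two, fun φ hφ hφ0 => ?_⟩
  have hzero : ∀ᵐ p ∂(arc.restrict (frontier D \ Γ)), φ p = 0 := by
    filter_upwards [ae_restrict_mem (isClosed_frontier.measurableSet.diff hΓ)] with p hp
    exact hφ0 p hp
  have hφD : MemLp φ 2 (volume.restrict D) :=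
    IsLipschitzDomain.memLp_of_continuous D hφ.continuous
  have hφΓ : MemLp φ 2 (arc.restrict Γ) :=
    (IsLipschitzDomain.memLp_frontier_of_continuous D hφ.continuous).mono_measure
      (Measure.restrict_mono hΓD le_rfl)
  have hφgreen := hgreen _ φ (H1.hasTrace_ofSmooth hφ) hzero
  have hφgreen' := hgreen' _ φ (H1.hasTrace_ofSmooth hφ) hzero
  calc ∫ p in D, φ p * (l p - l' p)
      = (∫ p in D, l p * φ p) - ∫ p in D, l' p * φ p :=
        integral_mul_sub_of_memLp_two hφD hl hl'
    _ = (∫ p in Γ, q p * φ p ∂arc) - ∫ p in Γ, q' p * φ p ∂arc := by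
        rw [← hφgreen, ← hφgreen', add_sub_add_left_eq_sub]
        rfl
    _ = ∫ p in Γ, φ p * (q p - q' p) ∂arc :=
        (integral_mul_sub_of_memLp_two hφΓ hq hq').symm

lemma ae_eq_zero_of_forall_integral_mul_eq (hD : IsOpen D) (hΓD : Γ ⊆ frontier D)
    {l q : Plane → ℝ} (hl : IntegrableOn l D)
    (hgreen : ∀ φ : Plane → ℝ, ContDiff ℝ ∞ φ → (∀ p ∈ frontier D \ Γ, φ p = 0) →
      ∫ p in D, φ p * l p = ∫ p in Γ, φ p * q p ∂arc) :
    l =ᵐ[volume.restrict D] 0 := by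
  refine (ae_restrict_iff' hD.measurableSet).2 <|
    hD.ae_eq_zero_of_integral_contDiff_smul_eq_zero hl.locallyIntegrableOn fun φ hφ _ hs => ?_
  have hout (p : Plane) (hp : p ∉ D) : φ p = 0 :=
    image_eq_zero_of_notMem_tsupport fun h => hp (hs h)
  have hfrontier (p : Plane) (hp : p ∈ frontier D) : φ p = 0 :=
    hout p (hD.frontier_eq ▸ hp).2
  calc ∫ p, φ p • l p = ∫ p in D, φ p * l p :=
        (setIntegral_eq_integral_of_forall_compl_eq_zero fun p hp => by
          rw [hout p hp, zero_smul]).symm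
    _ = ∫ p in Γ, φ p * q p ∂arc := hgreen φ hφ fun p hp => hfrontier p hp.1
    _ = 0 := setIntegral_eq_zero_of_forall_eq_zero fun p hp => by
        rw [hfrontier p (hΓD hp), zero_mul]

end NormalDeriv

namespace Geometry

variable (G : Geometry)

instance : IsFiniteMeasure (arc.restrict G.Γ) := ⟨by simp [arc_Γ]⟩

variable {G}

lemma memLp_Γ {w : Plane → ℝ} (hw : MemLp w 2 (arc.restrict (frontier G.Ω₂))) :
    MemLp w 2 (arc.restrict G.Γ) :=
  hw.mono_measure (Measure.restrict_mono G.Γ_subset_frontier le_rfl)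

lemma mem_Γ_of_mem_frontier {p : Plane} (hp : p ∈ frontier G.Ω₂) (h0 : p 0 < G.L₂)
    (h1 : p 1 ∈ Ioo 0 G.H) : p ∈ G.Γ := by
  rw [G.isOpen_Ω₂.frontier_eq] at hp
  refine ⟨le_antisymm ?_ ?_, h1⟩
  · by_contra! h
    exact hp.2 ((G.mem_Ω₂_iff h0).2 ⟨h, h1⟩)
  · have hclosed : IsClosed {p : Plane | G.L₀ ≤ p 0} :=
      isClosed_le continuous_const (by fun_prop)
    exact closure_minimal (fun q (hq : q ∈ G.Ω₂) => le_of_lt (mem_ofPred.1 hq.2)) hclosed hp.1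

lemma inter_frontier_subset_diff_Γ {s : Set Plane} (hs : s ⊆ frontier G.Ω) :
    s ∩ frontier G.Ω₂ ⊆ frontier G.Ω₂ \ G.Γ := fun _ hp =>
  ⟨hp.2, fun hΓ => (G.isOpen.frontier_eq ▸ hs hp.1).2 (G.Γ_subset_Ω hΓ)⟩

lemma exists_contDiff_extension {g : ℝ → ℝ} (hg : ContDiff ℝ ∞ g)
    (hg0 : ∀ z, z ∉ Ioo 0 G.H → g z = 0) :
    ∃ φ : Plane → ℝ, ContDiff ℝ ∞ φ ∧ (∀ p ∈ frontier G.Ω₂ \ G.Γ, φ p = 0) ∧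
      ∀ z, φ (pt G.L₀ z) = g z := by
  have hpos : 0 < G.L₂ - G.L₀ := sub_pos.2 G.L₀_lt
  refine ⟨fun p => Real.smoothTransition ((G.L₂ - p 0) / (G.L₂ - G.L₀)) * g (p 1), ?_,
    fun p hp => ?_, fun z => ?_⟩
  · exact (Real.smoothTransition.contDiff.comp (by fun_prop)).mul (hg.comp (by fun_prop))
  · by_contra! hne
    have h1 : p 1 ∈ Ioo 0 G.H := by
      by_contra h
      exact right_ne_zero_of_mul hne (hg0 _ h)
    have h0 : p 0 < G.L₂ := by
      by_contra! h
      exact left_ne_zero_of_mul hne (Real.smoothTransition.zero_of_nonpos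
        (div_nonpos_of_nonpos_of_nonneg (sub_nonpos.2 h) hpos.le))
    exact hp.2 (mem_Γ_of_mem_frontier hp.1 h0 h1)
  · simp only [pt_apply_zero, pt_apply_one, div_self hpos.ne', Real.smoothTransition.one, one_mul]

lemma ae_eq_of_hasNormalDeriv {u : H1 G.Ω₂} {q q' : Plane → ℝ} (h : u.HasNormalDeriv G.Γ q)
    (h' : u.HasNormalDeriv G.Γ q') : q =ᵐ[arc.restrict G.Γ] q' := by
  obtain ⟨l, hl, hgreen⟩ := h.exists_integral_mul_sub_eq G.measurableSet_Γ G.Γ_subset_frontier h'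
  have hl0 := ae_eq_zero_of_forall_integral_mul_eq G.isOpen_Ω₂ G.Γ_subset_frontier
    hl hgreen
  have hint : IntegrableOn (fun z => q (pt G.L₀ z) - q' (pt G.L₀ z)) (Ioo 0 G.H) := by
    have hqq' : Integrable (q - q') (arc.restrict G.Γ) := (h.1.sub h'.1).integrable one_le_two
    rwa [arc_restrict_Γ, G.measurableEmbedding_interface.integrable_map_iff] at hqq'
  have hzero : ∀ᵐ z : ℝ, z ∈ Ioo 0 G.H → q (pt G.L₀ z) - q' (pt G.L₀ z) = 0 := by
    refine isOpen_Ioo.ae_eq_zero_of_integral_contDiff_smul_eq_zero hint.locallyIntegrableOn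
      fun g hg _ hs => ?_
    have hg0 (z : ℝ) (hz : z ∉ Ioo 0 G.H) : g z = 0 :=
      image_eq_zero_of_notMem_tsupport fun h => hz (hs h)
    obtain ⟨φ, hφ, hφ0, hφg⟩ := exists_contDiff_extension hg hg0
    calc ∫ z, g z • (q (pt G.L₀ z) - q' (pt G.L₀ z))
        = ∫ z in Ioo 0 G.H, g z • (q (pt G.L₀ z) - q' (pt G.L₀ z)) :=
          (setIntegral_eq_integral_of_forall_compl_eq_zero fun z hz => by
            rw [hg0 z hz, zero_smul]).symm
      _ = ∫ p in G.Γ, φ p * (q p - q' p) ∂arc := by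
          simp only [arc_restrict_Γ, G.measurableEmbedding_interface.integral_map, hφg, smul_eq_mul]
      _ = ∫ p in G.Ω₂, φ p * l p := (hgreen φ hφ hφ0).symm
      _ = 0 := integral_eq_zero_of_ae (hl0.mono fun p hp => by simp [hp])
  rw [arc_restrict_Γ, EventuallyEq, G.measurableEmbedding_interface.ae_map_iff,
    ae_restrict_iff' measurableSet_Ioo]
  exact hzero.mono fun z hz hm => sub_eq_zero.1 (hz hm)

lemma avg_congr {f g : Plane → ℝ} (h : f =ᵐ[arc.restrict G.Γ] g) :
    G.avg f G.L₀ = G.avg g G.L₀ := by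
  rw [avg_eq_integral_Γ, avg_eq_integral_Γ, integral_congr_ae h]

lemma avg_mul_sub_const {f : Plane → ℝ} (hf : IntegrableOn f G.Γ arc) (a c : ℝ) :
    G.avg (fun p => a * f p - c) G.L₀ = a * G.avg f G.L₀ - c := by
  have hH := G.H_pos
  rw [avg_eq_integral_Γ, avg_eq_integral_Γ,
    integral_sub (hf.integrable.const_mul a) (integrable_const c), integral_const_mul,
    setIntegral_const, measureReal_def, arc_Γ, ENNReal.toReal_ofReal hH.le, smul_eq_mul]
  field_simp

end Geometry

section Reflection

open SchwarzCoupling.Geometry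

variable {G : Geometry} {κ lam c : ℝ} {F γ₂ w : Plane → ℝ} {u : H1 G.Ω₂}

lemma IsSolution2D.hasNormalDeriv (hu : IsSolution2D G κ lam F γ₂ c u) (hw : u.HasTrace w)
    (hF : MemLp F 2 (volume.restrict G.Ω₂)) :
    u.HasNormalDeriv G.Γ fun p => c - lam * w p := by
  obtain ⟨w', hw', -, hweak⟩ := hu
  refine ⟨(memLp_const c).sub ((memLp_Γ hw.1).const_mul lam), fun p => -F p, hF.neg,
    fun v y hy hy0 => ?_⟩
  have hzero {s : Set Plane} (hs : s ⊆ frontier G.Ω) :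
      ∀ᵐ p ∂(arc.restrict (s ∩ frontier G.Ω₂)), y p = 0 :=
    ae_restrict_of_ae_restrict_of_subset (inter_frontier_subset_diff_Γ hs) hy0
  have hbottom : ∫ p in G.ΓB ∩ frontier G.Ω₂, w' p * y p ∂arc = 0 :=
    integral_eq_zero_of_ae ((hzero G.ΓB_subset).mono fun p hp => by simp [hp])
  have hww' : ∫ p in G.Γ, w' p * y p ∂arc = ∫ p in G.Γ, w p * y p ∂arc :=
    integral_congr_ae <|
      (ae_restrict_of_ae_restrict_of_subset G.Γ_subset_frontier (hw'.ae_eq hw)).mono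
        fun p hp => by simp only [hp]
  have hrobin : ∫ p in G.Γ, (c - lam * w p) * y p ∂arc =
      (∫ p in G.Γ, c * y p ∂arc) - lam * ∫ p in G.Γ, w p * y p ∂arc := by
    have hyΓ := memLp_Γ hy.1
    have hwy : Integrable (fun p => w p * y p) (arc.restrict G.Γ) :=
      (memLp_Γ hw.1).integrable_mul hyΓ
    rw [← integral_const_mul lam, ← integral_sub ((hyΓ.integrable one_le_two).const_mul c)
      (hwy.const_mul lam)]
    congr! 2 with p
    ring
  have hgreen := hweak v y hy (hzero G.ΓR_subset)
  rw [hbottom, hww'] at hgreen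
  simp only [neg_mul, integral_neg]
  rw [hrobin]
  linear_combination hgreen

lemma IsSolution2D.hasInterfaceAverages_iff (hu : IsSolution2D G κ lam F γ₂ c u)
    (hw : u.HasTrace w) (hF : MemLp F 2 (volume.restrict G.Ω₂)) {m d : ℝ} :
    HasInterfaceAverages G u m d ↔ m = G.avg w G.L₀ ∧ d = lam * G.avg w G.L₀ - c := by
  have hflux := hu.hasNormalDeriv hw hF
  have havg : G.avg (fun p => -(c - lam * w p)) G.L₀ = lam * G.avg w G.L₀ - c := by
    simp only [neg_sub]
    exact avg_mul_sub_const ((memLp_Γ hw.1).integrable one_le_two) lam c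
  constructor
  · rintro ⟨w', q, hw', hq, rfl, rfl⟩
    refine ⟨avg_congr (ae_restrict_of_ae_restrict_of_subset G.Γ_subset_frontier (hw'.ae_eq hw)), ?_⟩
    rw [← havg]
    exact avg_congr (ae_eq_of_hasNormalDeriv hq hflux).neg
  · rintro ⟨rfl, rfl⟩
    exact ⟨w, _, hw, hflux, rfl, havg.symm⟩

lemma IsSolution2D.exists_hasInterfaceAverages (hu : IsSolution2D G κ lam F γ₂ c u)
    (hF : MemLp F 2 (volume.restrict G.Ω₂)) : ∃ m d, HasInterfaceAverages G u m d :=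
  have ⟨_, hw, _⟩ := hu
  ⟨_, _, (hu.hasInterfaceAverages_iff hw hF).2 ⟨rfl, rfl⟩⟩

lemma IsSolution2D.neg_add_mul_eq (hu : IsSolution2D G κ lam F γ₂ c u)
    (hF : MemLp F 2 (volume.restrict G.Ω₂)) {m d : ℝ} (h : HasInterfaceAverages G u m d) :
    -d + lam * m = c := by
  have ⟨w, hw, _⟩ := hu
  obtain ⟨rfl, rfl⟩ := (hu.hasInterfaceAverages_iff hw hF).1 h
  ring

/-- `R` is the Robin reflection map of the 2-D model: a solution that takes in the datum
`c = -∂u/∂x + lam u` on `Γ` gives out the datum `R c`, the average of `∂u/∂x + lam u` over `Γ`. -/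
def IsReflection2D (G : Geometry) (κ lam : ℝ) (F γ₂ : Plane → ℝ) (R : ℝ → ℝ) : Prop :=
  ∀ c u, IsSolution2D G κ lam F γ₂ c u → ∀ m d, HasInterfaceAverages G u m d → d + lam * m = R c

lemma exists_isReflection2D (hκ : 0 ≤ κ) (hlam : 0 < lam)
    (hF : MemLp F 2 (volume.restrict G.Ω₂)) (hγ₂ : IsDirichletDatum G γ₂) :
    ∃ R, LipschitzWith 1 R ∧ IsReflection2D G κ lam F γ₂ R := by
  choose v hv using fun c => exists_isSolution2D (G := G) hκ hlam hF hγ₂ c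
  have hv' := hv
  choose y hy _ using hv'
  refine ⟨fun c => 2 * lam * G.avg (y c) G.L₀ - c, LipschitzWith.of_dist_le_mul fun c c' => ?_,
    fun c u hu m d hmd => ?_⟩
  · rw [NNReal.coe_one, one_mul, Real.dist_eq, Real.dist_eq]
    exact (hv c).abs_reflection_sub_le (hv c') (hy c) (hy c') hF hκ hlam
  · have ⟨w, hw, _⟩ := hu
    obtain ⟨rfl, rfl⟩ := (hu.hasInterfaceAverages_iff hw hF).1 hmd
    have hwell := hu.abs_reflection_sub_le (hv c) hw (hy c) hF hκ hlam
    rw [sub_self, abs_zero, abs_nonpos_iff, sub_eq_zero] at hwell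
    linear_combination hwell

end Reflection

/-! ### The Schwarz iteration -/

lemma Geometry.memLp_Ω₂ {G : Geometry} {F : Plane → ℝ} (hF : MemLp F 2 (volume.restrict G.Ω)) :
    MemLp F 2 (volume.restrict G.Ω₂) :=
  hF.mono_measure (Measure.restrict_mono inter_subset_left le_rfl)

section Schwarz

open SchwarzCoupling.Geometry

variable {G : Geometry} {κ lam : ℝ} {F γ₁ γ₂ : Plane → ℝ} {T R : ℝ → ℝ}

lemma exists_isSchwarzIteration (hκ : 0 ≤ κ) (hlam : 0 < lam)
    (hF : MemLp F 2 (volume.restrict G.Ω)) (hγ₂ : IsDirichletDatum G γ₂) (u₀ : H1 G.Ω₂)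
    (hu₀ : ∃ m d, HasInterfaceAverages G u₀ m d) :
    ∃ (u₁ du₁ : ℕ → ℝ → ℝ) (u₂ : ℕ → H1 G.Ω₂), u₂ 0 = u₀ ∧
      IsSchwarzIteration G κ lam F γ₁ γ₂ u₁ du₁ u₂ := by
  have hstep (v : {v : H1 G.Ω₂ // ∃ m d, HasInterfaceAverages G v m d}) :
      ∃ (u du : ℝ → ℝ) (v' : {v : H1 G.Ω₂ // ∃ m d, HasInterfaceAverages G v m d}),
        IsSolution1D G κ F γ₁ u du ∧ Robin1D G lam u du v ∧
          IsSolution2D G κ lam F γ₂ (robinDatum2D G lam u du) v' := by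
    obtain ⟨v, m, d, hmd⟩ := v
    obtain ⟨u, du, hu, hdatum⟩ := exists_isSolution1D_robinDatum1D_eq (γ₁ := γ₁) hκ hlam hF
      (d + lam * m)
    obtain ⟨v', hv'⟩ := exists_isSolution2D hκ hlam (memLp_Ω₂ hF) hγ₂ (robinDatum2D G lam u du)
    exact ⟨u, du, ⟨v', hv'.exists_hasInterfaceAverages (memLp_Ω₂ hF)⟩, hu, ⟨m, d, hmd, hdatum⟩, hv'⟩
  choose u du next hsol1D hrobin hsol2D using hstep
  let v (k : ℕ) := next^[k] ⟨u₀, hu₀⟩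
  refine ⟨fun k => u (v (k - 1)), fun k => du (v (k - 1)), fun k => v k, rfl,
    fun k => ⟨hsol1D _, hrobin _, ?_⟩⟩
  simp only [v, Function.iterate_succ_apply', Nat.add_sub_cancel]
  exact hsol2D _

/-- Both Robin data of the 1-D and the 2-D solution agree when `c` is a fixed point of the two
reflections, and they determine the value and the derivative since `lam ≠ 0`. -/
lemma exists_coupled_solution (hκ : 0 ≤ κ) (hlam : 0 < lam)
    (hF : MemLp F 2 (volume.restrict G.Ω)) (hγ₂ : IsDirichletDatum G γ₂)
    (hT : IsReflection1D G κ lam F γ₁ T) (hR : IsReflection2D G κ lam F γ₂ R) {c : ℝ}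
    (hc : T (R c) = c) :
    ∃ (u du : ℝ → ℝ) (v : H1 G.Ω₂), robinDatum1D G lam u du = R c ∧ robinDatum2D G lam u du = c ∧
      IsSolution1D G κ F γ₁ u du ∧ IsSolution2D G κ lam F γ₂ c v ∧
        HasInterfaceAverages G v (u G.L₀) (du G.L₀) := by
  obtain ⟨u, du, hu, hu1D⟩ := exists_isSolution1D_robinDatum1D_eq (γ₁ := γ₁) hκ hlam hF (R c)
  obtain ⟨v, hv⟩ := exists_isSolution2D hκ hlam (memLp_Ω₂ hF) hγ₂ c
  obtain ⟨m, d, hmd⟩ := hv.exists_hasInterfaceAverages (memLp_Ω₂ hF)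
  have hu2D : robinDatum2D G lam u du = c := by rw [hT u du hu, hu1D, hc]
  have hin : -du G.L₀ + lam * u G.L₀ = -d + lam * m :=
    hu2D.trans (hv.neg_add_mul_eq (memLp_Ω₂ hF) hmd).symm
  have hout : du G.L₀ + lam * u G.L₀ = d + lam * m := hu1D.trans (hR c v hv m d hmd).symm
  obtain rfl : u G.L₀ = m := mul_left_cancel₀ hlam.ne' (by linarith)
  obtain rfl : du G.L₀ = d := by linarith
  exact ⟨u, du, v, hu1D, hu2D, hu, hv, hmd⟩

variable {u₁ du₁ : ℕ → ℝ → ℝ} {u₂ : ℕ → H1 G.Ω₂}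

lemma IsSchwarzIteration.robinDatum1D_add_two
    (h : IsSchwarzIteration G κ lam F γ₁ γ₂ u₁ du₁ u₂) (hR : IsReflection2D G κ lam F γ₂ R)
    (k : ℕ) : robinDatum1D G lam (u₁ (k + 2)) (du₁ (k + 2)) =
      R (robinDatum2D G lam (u₁ (k + 1)) (du₁ (k + 1))) := by
  obtain ⟨m, d, hmd, hrobin⟩ := (h (k + 1)).2.1
  exact hrobin.trans (hR _ _ (h k).2.2 m d hmd)

lemma IsSchwarzIteration.robinDatum2D_succ
    (h : IsSchwarzIteration G κ lam F γ₁ γ₂ u₁ du₁ u₂) (hT : IsReflection1D G κ lam F γ₁ T)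
    (hR : IsReflection2D G κ lam F γ₂ R) (k : ℕ) :
    robinDatum2D G lam (u₁ (k + 1)) (du₁ (k + 1)) =
      (T ∘ R)^[k] (robinDatum2D G lam (u₁ 1) (du₁ 1)) := by
  induction k with
  | zero => rfl
  | succ k ih =>
    rw [Function.iterate_succ_apply', ← ih, hT _ _ (h (k + 1)).1, h.robinDatum1D_add_two hR k]
    rfl

lemma IsSchwarzIteration.tendsto_robinDatum2D
    (h : IsSchwarzIteration G κ lam F γ₁ γ₂ u₁ du₁ u₂) (hT : IsReflection1D G κ lam F γ₁ T)
    (hR : IsReflection2D G κ lam F γ₂ R) {ρ : ℝ≥0} (hTR : ContractingWith ρ (T ∘ R)) :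
    Tendsto (fun k => robinDatum2D G lam (u₁ k) (du₁ k)) atTop
      (𝓝 (ContractingWith.fixedPoint (T ∘ R) hTR)) := by
  refine (tendsto_add_atTop_iff_nat 1).1 ?_
  exact (hTR.tendsto_iterate_fixedPoint _).congr fun k => (h.robinDatum2D_succ hT hR k).symm

lemma IsSchwarzIteration.tendsto_robinDatum1D
    (h : IsSchwarzIteration G κ lam F γ₁ γ₂ u₁ du₁ u₂) (hR : IsReflection2D G κ lam F γ₂ R)
    (hcont : Continuous R) {c : ℝ}
    (hc : Tendsto (fun k => robinDatum2D G lam (u₁ k) (du₁ k)) atTop (𝓝 c)) :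
    Tendsto (fun k => robinDatum1D G lam (u₁ k) (du₁ k)) atTop (𝓝 (R c)) := by
  refine (tendsto_add_atTop_iff_nat 2).1 ?_
  simp only [h.robinDatum1D_add_two hR]
  exact (hcont.tendsto c).comp ((tendsto_add_atTop_iff_nat 1).2 hc)

lemma IsSchwarzIteration.eventually_isSolution
    (h : IsSchwarzIteration G κ lam F γ₁ γ₂ u₁ du₁ u₂) :
    ∀ᶠ k in atTop, IsSolution1D G κ F γ₁ (u₁ k) (du₁ k) ∧
      IsSolution2D G κ lam F γ₂ (robinDatum2D G lam (u₁ k) (du₁ k)) (u₂ k) :=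
  eventually_atTop.2 ⟨1, fun k hk => by
    obtain ⟨k, rfl⟩ := Nat.exists_eq_add_of_le' hk
    exact ⟨(h k).1, (h k).2.2⟩⟩

end Schwarz

end SchwarzCoupling

end

open SchwarzCoupling in
theorem mainTheorem1 (G : SchwarzCoupling.Geometry) (κ : ℝ) (hκ : 0 ≤ κ)
    (F γ₁ γ₂ : SchwarzCoupling.Plane → ℝ)
    (hF : MemLp F 2 (volume.restrict G.Ω))
    (hγ₁ : IntervalIntegrable (fun z => γ₁ (SchwarzCoupling.pt 0 z)) volume 0 G.H)
    (hγ₂ : SchwarzCoupling.IsDirichletDatum G γ₂)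
    (lam : ℝ) (hlam : 0 < lam) :
    -- the algorithm is well defined for every initial guess with a value and a flux on `Γ`
    (∀ u₂init : SchwarzCoupling.H1 G.Ω₂,
      (∃ m d : ℝ, SchwarzCoupling.HasInterfaceAverages G u₂init m d) →
      ∃ (u₁ du₁ : ℕ → ℝ → ℝ) (u₂ : ℕ → SchwarzCoupling.H1 G.Ω₂), u₂ 0 = u₂init ∧
        SchwarzCoupling.IsSchwarzIteration G κ lam F γ₁ γ₂ u₁ du₁ u₂) ∧
    -- there is a limit, depending only on `lam` and the data of the problem
    ∃ (u₁lim du₁lim : ℝ → ℝ) (u₂lim : SchwarzCoupling.H1 G.Ω₂),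
      -- it solves the two models with the Robin condition on `Γ`
      SchwarzCoupling.IsSolution1D G κ F γ₁ u₁lim du₁lim ∧
      SchwarzCoupling.IsSolution2D G κ lam F γ₂
        (SchwarzCoupling.robinDatum2D G lam u₁lim du₁lim) u₂lim ∧
      -- it satisfies the physical constraints
      SchwarzCoupling.HasInterfaceAverages G u₂lim (u₁lim G.L₀) (du₁lim G.L₀) ∧
      -- every Schwarz iteration converges to it
      ∀ (u₁ du₁ : ℕ → ℝ → ℝ) (u₂ : ℕ → SchwarzCoupling.H1 G.Ω₂),
        SchwarzCoupling.IsSchwarzIteration G κ lam F γ₁ γ₂ u₁ du₁ u₂ →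
        SchwarzCoupling.ConvergesH1Interval G.L₀ u₁ du₁ u₁lim du₁lim ∧
        SchwarzCoupling.ConvergesH1 u₂ u₂lim := by
  have hF₂ := Geometry.memLp_Ω₂ hF
  obtain ⟨ρ, T, hρ, hTlip, hT⟩ := exists_isReflection1D (γ₁ := γ₁) hκ hlam hF
  obtain ⟨R, hRlip, hR⟩ := exists_isReflection2D hκ hlam hF₂ hγ₂
  have hTR : ContractingWith ρ (T ∘ R) := ⟨hρ, by simpa using hTlip.comp hRlip⟩
  obtain ⟨u, du, v, hu1D, hu2D, hu, hv, havg⟩ :=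
    exists_coupled_solution hκ hlam hF hγ₂ hT hR hTR.fixedPoint_isFixedPt
  refine ⟨exists_isSchwarzIteration hκ hlam hF hγ₂, u, du, v, hu, hu2D ▸ hv, havg,
    fun u₁ du₁ u₂ hiter => ?_⟩
  have hdatum2D := hiter.tendsto_robinDatum2D hT hR hTR
  have hdatum1D := hiter.tendsto_robinDatum1D hR hRlip.continuous hdatum2D
  exact ⟨convergesH1Interval_of_tendsto_robinDatum1D hκ hlam
      (hiter.eventually_isSolution.mono fun _ h => h.1) hu (hu1D ▸ hdatum1D),
    convergesH1_of_tendsto hκ hlam hF₂ (hiter.eventually_isSolution.mono fun _ h => h.2) hv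
      hdatum2D⟩
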